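/- Let $\theta$ be an irrational real number, $\lambda=e^{2\pi i\theta}$, and let $A_\theta^\infty$ be the algebra of the noncommutative two-torus: all series $\sum_{n,m\in\mathbb Z}s_{n,m}U_1^nU_2^m$ with $(s_{n,m})$ of rapid decay, where $U_1,U_2$ are invertible with $U_2U_1=\lambda U_1U_2$. Let $\tau(\sum s_{n,m}U_1^nU_2^m)=s_{0,0}$ be its trace, and for $X=(x_1,x_2)\in\mathbb R^2=\mathrm{Lie}(\mathbb T^2)$ let $\delta_X$ be the derivation with $\delta_X(U_1^nU_2^m)=2\pi i(nx_1+mx_2)U_1^nU_2^m$. Let $p\in\mathbb Z$, let $q\ge1$ be an integer, let $W_1,W_2$ be unitaries of $\mathbb C^q$ with $W_1W_2=e^{2\pi i/q}W_2W_1$, and put $\varepsilon=\frac pq-\theta$. Make $\mathcal S(\mathbb R)\otimes\mathbb C^q$ (Schwartz functions on $\mathbb R$ with values in $\mathbb C^q$) a right $A_\theta^\infty$-module by $$(\xi\cdot U_1)(s)=W_1\,\xi(s-\varepsilon),\qquad(\xi\cdot U_2)(s)=e^{2\pi is}\,W_2^p\,\xi(s),\qquad \xi\cdot\sum s_{n,m}U_1^nU_2^m=\sum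 s_{n,m}\,(\xi\cdot U_1^n)\cdot U_2^m .$$ Then this module is projective of finite type, of dimension $|p-q\theta|$; that is, it is isomorphic to $e(A_\theta^\infty)^n$ for some $n$ and some idempotent $e\in M_n(A_\theta^\infty)$ with $(\tau\otimes\mathrm{Tr})(e)=|p-q\theta|$. The equalities $$(\nabla_1\xi)(s)=\frac{2\pi is}{\varepsilon}\,\xi(s),\qquad(\nabla_2\xi)(s)=\frac{d}{ds}\xi(s)$$ define a connection on it, i.e. with $\nabla_X=x_1\nabla_1+x_2\nabla_2$ one has $\nabla_X(\xi\cdot a)=\nabla_X(\xi)\cdot a+\xi\cdot\delta_X(a)$ for all $X$, $\xi$ and $a\in A_\theta^\infty$. Its curvature $\Theta=\nabla_1\nabla_2-\nabla_2\nabla_1$ is constant, equal to $\frac1{\theta-p/q}$ in units of $2\pi i$: $$\Theta=2\pi i\cdot\frac{1}{\theta-p/q}\,\mathrm{id}.$$ Hence the total curvature $\frac1{2\pi i}\tau(\Theta)$, where $\tau$ is extended to the endomorphisms of the module by $\tau\otimes\mathrm{Tr}$ on $eM_n(A_\theta^\infty)e$, equals $$\frac{|p-q\theta|}{\theta-p/q}=\pm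 q .$$ -/

import Mathlib

open scoped SchwartzMap ContDiff

noncomputable section

namespace NCTorus

/-- The weight `1 + |n| + |m|` on `ℤ²`. -/
def weight (x : ℤ × ℤ) : ℝ := 1 + |(x.1 : ℝ)| + |(x.2 : ℝ)|

/-- Rapid decay of a double sequence: it stays bounded after multiplication by any power of
`1 + |n| + |m|`. -/
def RapidDecay (a : ℤ × ℤ → ℂ) : Prop :=
  ∀ k : ℕ, ∃ C : ℝ, ∀ x, weight x ^ k * ‖a x‖ ≤ C

lemma one_le_weight (x : ℤ × ℤ) : 1 ≤ weight x := by
  unfold weight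
  have := abs_nonneg (x.1 : ℝ)
  have := abs_nonneg (x.2 : ℝ)
  linarith

lemma weight_pos (x : ℤ × ℤ) : 0 < weight x := lt_of_lt_of_le one_pos (one_le_weight x)

lemma weight_add_le (x y : ℤ × ℤ) : weight (x + y) ≤ weight x * weight y := by
  unfold weight
  simp only [Prod.fst_add, Prod.snd_add, Int.cast_add]
  have h1 := abs_add_le (x.1 : ℝ) y.1
  have h2 := abs_add_le (x.2 : ℝ) y.2
  have a1 := abs_nonneg (x.1 : ℝ)
  have a2 := abs_nonneg (x.2 : ℝ)
  have b1 := abs_nonneg (y.1 : ℝ)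
  have b2 := abs_nonneg (y.2 : ℝ)
  nlinarith [mul_nonneg a1 b1, mul_nonneg a1 b2, mul_nonneg a2 b1, mul_nonneg a2 b2]

lemma summable_weight_inv : Summable (fun x : ℤ × ℤ => (weight x ^ 4)⁻¹) := by
  have h1 : Summable (fun n : ℤ => ((1 + |(n : ℝ)|) ^ 2)⁻¹) := by
    have h0 : Summable (fun n : ℤ => 1 / (n : ℝ) ^ 2) :=
      Real.summable_one_div_int_pow.mpr (by norm_num)
    refine Summable.of_norm_bounded_eventually (g := fun n : ℤ => 1 / (n : ℝ) ^ 2) h0 ?_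
    have : ({0}ᶜ : Set ℤ) ∈ Filter.cofinite := (Set.finite_singleton 0).compl_mem_cofinite
    filter_upwards [this] with n hn
    have hn' : (n : ℝ) ≠ 0 := by exact_mod_cast hn
    have hp : 0 < (n : ℝ) ^ 2 := by positivity
    rw [Real.norm_of_nonneg (by positivity), one_div]
    apply inv_anti₀ hp
    rw [← sq_abs (n : ℝ)]
    gcongr
    linarith
  have h2 := h1.mul_of_nonneg h1 (fun n => by positivity) (fun n => by positivity)
  refine Summable.of_nonneg_of_le (fun x => by have := weight_pos x; positivity) (fun x => ?_) h2
  rw [← mul_inv]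
  apply inv_anti₀ (by positivity)
  have e : weight x ^ 4 = weight x ^ 2 * weight x ^ 2 := by ring
  rw [e]
  have a1 := abs_nonneg (x.1 : ℝ)
  have a2 := abs_nonneg (x.2 : ℝ)
  gcongr <;> (unfold weight; linarith)

lemma RapidDecay.summable_weight {a : ℤ × ℤ → ℂ} (h : RapidDecay a) (k : ℕ) :
    Summable (fun x => weight x ^ k * ‖a x‖) := by
  obtain ⟨C, hC⟩ := h (k + 4)
  refine Summable.of_nonneg_of_le (fun x => by have := weight_pos x; positivity) (fun x => ?_)
    (summable_weight_inv.mul_left C)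
  have hw := weight_pos x
  have := hC x
  rw [← div_eq_mul_inv, le_div_iff₀ (by positivity)]
  calc weight x ^ k * ‖a x‖ * weight x ^ 4 = weight x ^ (k + 4) * ‖a x‖ := by ring
    _ ≤ C := this

lemma RapidDecay.summable_norm {a : ℤ × ℤ → ℂ} (h : RapidDecay a) :
    Summable (fun x => ‖a x‖) := by
  simpa using h.summable_weight 0

lemma RapidDecay.add {a b : ℤ × ℤ → ℂ} (ha : RapidDecay a) (hb : RapidDecay b) :
    RapidDecay (a + b) := by
  intro k
  obtain ⟨C, hC⟩ := ha k
  obtain ⟨D, hD⟩ := hb k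
  refine ⟨C + D, fun x => ?_⟩
  have hw := weight_pos x
  calc weight x ^ k * ‖(a + b) x‖ ≤ weight x ^ k * (‖a x‖ + ‖b x‖) := by
        gcongr; exact norm_add_le _ _
    _ ≤ C + D := by rw [mul_add]; exact add_le_add (hC x) (hD x)

lemma RapidDecay.smul {a : ℤ × ℤ → ℂ} (ha : RapidDecay a) (c : ℂ) :
    RapidDecay (c • a) := by
  intro k
  obtain ⟨C, hC⟩ := ha k
  refine ⟨‖c‖ * C, fun x => ?_⟩
  calc weight x ^ k * ‖(c • a) x‖ = ‖c‖ * (weight x ^ k * ‖a x‖) := by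
        simp only [Pi.smul_apply, norm_smul]; ring
    _ ≤ ‖c‖ * C := by gcongr; exact hC x

lemma rapidDecay_zero : RapidDecay 0 := fun k => ⟨0, fun x => by simp⟩

lemma rapidDecay_single (y : ℤ × ℤ) (c : ℂ) : RapidDecay (Pi.single y c) := by
  intro k
  refine ⟨weight y ^ k * ‖c‖, fun x => ?_⟩
  have hw := weight_pos y
  by_cases h : x = y
  · subst h; simp
  · simp only [Pi.single_eq_of_ne h, norm_zero, mul_zero]; positivity

/-- The phase `λ^{m n'}`, `λ = exp (2 π i θ)`, which occurs in
`U₁ⁿ U₂ᵐ · U₁^{n'} U₂^{m'} = λ^{m n'} U₁^{n + n'} U₂^{m + m'}`. -/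
def phase (θ : ℝ) (x y : ℤ × ℤ) : ℂ :=
  Complex.exp (2 * Real.pi * Complex.I * (θ * (x.2 * y.1)))

lemma norm_phase (θ : ℝ) (x y : ℤ × ℤ) : ‖phase θ x y‖ = 1 := by
  have : phase θ x y = Complex.exp (((2 * Real.pi * (θ * (x.2 * y.1)) : ℝ) : ℂ) * Complex.I) := by
    unfold phase; congr 1; push_cast; ring
  rw [this, Complex.norm_exp_ofReal_mul_I]

lemma phase_cocycle (θ : ℝ) (x y z : ℤ × ℤ) :
    phase θ x y * phase θ (x + y) z = phase θ x (y + z) * phase θ y z := by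
  simp only [phase, ← Complex.exp_add]
  congr 1
  simp only [Prod.fst_add, Prod.snd_add, Int.cast_add]
  ring

lemma phase_zero_left (θ : ℝ) (x : ℤ × ℤ) : phase θ 0 x = 1 := by simp [phase]

lemma phase_zero_right (θ : ℝ) (x : ℤ × ℤ) : phase θ x 0 = 1 := by simp [phase]

/-- Coefficients of the product of two series `∑ s_{n,m} U₁ⁿ U₂ᵐ` where `U₂ U₁ = λ U₁ U₂`. -/
def twistedConv (θ : ℝ) (a b : ℤ × ℤ → ℂ) (z : ℤ × ℤ) : ℂ :=
  ∑' x, a x * b (z - x) * phase θ x (z - x)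

lemma summable_twistedConv (θ : ℝ) {a b : ℤ × ℤ → ℂ} (ha : RapidDecay a) (hb : RapidDecay b)
    (z : ℤ × ℤ) : Summable (fun x => a x * b (z - x) * phase θ x (z - x)) := by
  obtain ⟨C, hC⟩ := hb 0
  refine Summable.of_norm_bounded (ha.summable_norm.mul_right C) (fun x => ?_)
  rw [norm_mul, norm_mul, norm_phase, mul_one]
  gcongr
  simpa using hC (z - x)

lemma RapidDecay.twistedConv {θ : ℝ} {a b : ℤ × ℤ → ℂ} (ha : RapidDecay a) (hb : RapidDecay b) :
    RapidDecay (twistedConv θ a b) := by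
  intro k
  obtain ⟨C, hC⟩ := hb k
  have hs := (ha.summable_weight k).mul_right C
  refine ⟨∑' x, weight x ^ k * ‖a x‖ * C, fun z => ?_⟩
  have hz := weight_pos z
  have hle : ∀ x, weight z ^ k * ‖a x * b (z - x) * phase θ x (z - x)‖ ≤
      weight x ^ k * ‖a x‖ * C := by
    intro x
    have hx := weight_pos x
    rw [norm_mul, norm_mul, norm_phase, mul_one]
    have hw : weight z ≤ weight x * weight (z - x) := by
      simpa using weight_add_le x (z - x)
    calc weight z ^ k * (‖a x‖ * ‖b (z - x)‖)
        ≤ (weight x * weight (z - x)) ^ k * (‖a x‖ * ‖b (z - x)‖) := by gcongr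
      _ = weight x ^ k * ‖a x‖ * (weight (z - x) ^ k * ‖b (z - x)‖) := by ring
      _ ≤ _ := by gcongr; exact hC _
  have hn := (summable_twistedConv θ ha hb z).norm
  calc weight z ^ k * ‖NCTorus.twistedConv θ a b z‖
      ≤ weight z ^ k * ∑' x, ‖a x * b (z - x) * phase θ x (z - x)‖ := by
        gcongr; exact norm_tsum_le_tsum_norm hn
    _ = ∑' x, weight z ^ k * ‖a x * b (z - x) * phase θ x (z - x)‖ := by rw [tsum_mul_left]
    _ ≤ _ := (hn.mul_left _).tsum_le_tsum hle hs

/-- Pairing a product with a bounded vector-valued function. -/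
lemma tsum_twistedConv_smul (θ : ℝ) {a b : ℤ × ℤ → ℂ} (ha : RapidDecay a) (hb : RapidDecay b)
    {F : Type*} [NormedAddCommGroup F] [NormedSpace ℂ F] [CompleteSpace F]
    (φ : ℤ × ℤ → F) (B : ℝ) (hφ : ∀ z, ‖φ z‖ ≤ B) :
    Summable (fun w : (ℤ × ℤ) × (ℤ × ℤ) =>
        (a w.1 * b w.2 * phase θ w.1 w.2) • φ (w.1 + w.2)) ∧
      ∑' z, twistedConv θ a b z • φ z =
        ∑' w : (ℤ × ℤ) × (ℤ × ℤ), (a w.1 * b w.2 * phase θ w.1 w.2) • φ (w.1 + w.2) := by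
  have hab := ha.summable_norm.mul_of_nonneg hb.summable_norm (fun _ => norm_nonneg _)
    (fun _ => norm_nonneg _)
  have hs : Summable (fun w : (ℤ × ℤ) × (ℤ × ℤ) =>
        (a w.1 * b w.2 * phase θ w.1 w.2) • φ (w.1 + w.2)) := by
    refine Summable.of_norm_bounded (hab.mul_right B) (fun w => ?_)
    rw [norm_smul, norm_mul, norm_mul, norm_phase, mul_one]
    gcongr
    exact hφ _
  refine ⟨hs, ?_⟩
  let e : (ℤ × ℤ) × (ℤ × ℤ) ≃ (ℤ × ℤ) × (ℤ × ℤ) :=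
    { toFun := fun w => (w.2, w.1 - w.2)
      invFun := fun w => (w.1 + w.2, w.1)
      left_inv := fun w => by simp
      right_inv := fun w => by simp }
  have hs' := (e.summable_iff).mpr hs
  rw [← e.tsum_eq]
  refine Eq.trans ?_ hs'.tsum_prod.symm
  refine tsum_congr (fun z => ?_)
  unfold twistedConv
  rw [← (summable_twistedConv θ ha hb z).tsum_smul_const]
  refine tsum_congr (fun x => ?_)
  simp [e]

/-- The algebra `A_θ^∞` of the noncommutative two-torus: double sequences `(s_{n,m})` of rapid
decay, `s` standing for `∑ s_{n,m} U₁ⁿ U₂ᵐ`. -/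
@[ext]
structure SmoothTorus (θ : ℝ) where
  /-- The coefficient of `U₁ⁿ U₂ᵐ` is `coeff (n, m)`. -/
  coeff : ℤ × ℤ → ℂ
  rapidDecay : RapidDecay coeff

namespace SmoothTorus

variable {θ : ℝ}

instance : Zero (SmoothTorus θ) := ⟨⟨0, rapidDecay_zero⟩⟩
instance : Add (SmoothTorus θ) := ⟨fun a b => ⟨a.coeff + b.coeff, a.rapidDecay.add b.rapidDecay⟩⟩
instance : SMul ℂ (SmoothTorus θ) := ⟨fun c a => ⟨c • a.coeff, a.rapidDecay.smul c⟩⟩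
instance : Neg (SmoothTorus θ) :=
  ⟨fun a => ⟨-a.coeff, by simpa using a.rapidDecay.smul (-1)⟩⟩
instance : One (SmoothTorus θ) := ⟨⟨Pi.single 0 1, rapidDecay_single 0 1⟩⟩
instance : Mul (SmoothTorus θ) :=
  ⟨fun a b => ⟨twistedConv θ a.coeff b.coeff, a.rapidDecay.twistedConv b.rapidDecay⟩⟩

lemma coeff_zero : (0 : SmoothTorus θ).coeff = 0 := rfl
lemma coeff_add (a b : SmoothTorus θ) : (a + b).coeff = a.coeff + b.coeff := rfl
lemma coeff_neg (a : SmoothTorus θ) : (-a).coeff = -a.coeff := rfl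
lemma coeff_smul (c : ℂ) (a : SmoothTorus θ) : (c • a).coeff = c • a.coeff := rfl
lemma coeff_one : (1 : SmoothTorus θ).coeff = Pi.single 0 1 := rfl
lemma coeff_mul (a b : SmoothTorus θ) : (a * b).coeff = twistedConv θ a.coeff b.coeff := rfl

lemma coeff_bounded (a : SmoothTorus θ) : ∃ C, ∀ x, ‖a.coeff x‖ ≤ C := by
  obtain ⟨C, hC⟩ := a.rapidDecay 0
  exact ⟨C, fun x => by simpa using hC x⟩

protected lemma mul_assoc (a b c : SmoothTorus θ) : a * b * c = a * (b * c) := by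
  ext z
  obtain ⟨C, hC⟩ := c.coeff_bounded
  simp only [coeff_mul]
  have h := tsum_twistedConv_smul θ a.rapidDecay b.rapidDecay
    (fun u => c.coeff (z - u) * phase θ u (z - u)) C
    (fun u => by rw [norm_mul, norm_phase, mul_one]; exact hC _)
  calc twistedConv θ (twistedConv θ a.coeff b.coeff) c.coeff z
      = ∑' u, twistedConv θ a.coeff b.coeff u • (c.coeff (z - u) * phase θ u (z - u)) := by
        simp only [smul_eq_mul, ← mul_assoc]; rfl
    _ = _ := h.2
    _ = _ := h.1.tsum_prod
    _ = twistedConv θ a.coeff (twistedConv θ b.coeff c.coeff) z := ?_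
  unfold twistedConv
  refine tsum_congr (fun x => ?_)
  rw [mul_right_comm, ← tsum_mul_left]
  refine tsum_congr (fun y => ?_)
  have hc := phase_cocycle θ x y (z - x - y)
  have e1 : y + (z - x - y) = z - x := by abel
  rw [e1] at hc
  have e2 : z - (x + y) = z - x - y := by abel
  simp only [smul_eq_mul, e2]
  linear_combination (a.coeff x * b.coeff y * c.coeff (z - x - y)) * hc

protected lemma one_mul (a : SmoothTorus θ) : 1 * a = a := by
  ext z
  rw [coeff_mul, twistedConv, tsum_eq_single 0]
  · simp [coeff_one, phase_zero_left]
  · intro x hx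
    simp [coeff_one, Pi.single_eq_of_ne hx]

protected lemma mul_one (a : SmoothTorus θ) : a * 1 = a := by
  ext z
  rw [coeff_mul, twistedConv, tsum_eq_single z]
  · simp [coeff_one, phase_zero_right]
  · intro x hx
    simp [coeff_one, Pi.single_eq_of_ne (sub_ne_zero.mpr (Ne.symm hx))]

protected lemma add_mul (a b c : SmoothTorus θ) : (a + b) * c = a * c + b * c := by
  ext z
  simp only [coeff_mul, coeff_add, twistedConv, Pi.add_apply, add_mul]
  exact (summable_twistedConv θ a.rapidDecay c.rapidDecay z).tsum_add
    (summable_twistedConv θ b.rapidDecay c.rapidDecay z)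

protected lemma mul_add (a b c : SmoothTorus θ) : a * (b + c) = a * b + a * c := by
  ext z
  simp only [coeff_mul, coeff_add, twistedConv, Pi.add_apply, add_mul, mul_add]
  exact (summable_twistedConv θ a.rapidDecay b.rapidDecay z).tsum_add
    (summable_twistedConv θ a.rapidDecay c.rapidDecay z)

instance : AddCommGroup (SmoothTorus θ) where
  add_assoc a b c := by ext; simp [coeff_add, add_assoc]
  zero_add a := by ext; simp [coeff_add, coeff_zero]
  add_zero a := by ext; simp [coeff_add, coeff_zero]
  add_comm a b := by ext; simp [coeff_add, add_comm]
  neg_add_cancel a := by ext; simp [coeff_add, coeff_neg, coeff_zero]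
  nsmul := nsmulRec
  zsmul := zsmulRec

instance : Ring (SmoothTorus θ) where
  __ := (inferInstance : AddCommGroup (SmoothTorus θ))
  mul_assoc := SmoothTorus.mul_assoc
  one_mul := SmoothTorus.one_mul
  mul_one := SmoothTorus.mul_one
  left_distrib := SmoothTorus.mul_add
  right_distrib := SmoothTorus.add_mul
  zero_mul a := by ext z; simp [coeff_mul, coeff_zero, twistedConv]
  mul_zero a := by ext z; simp [coeff_mul, coeff_zero, twistedConv]

instance : Module ℂ (SmoothTorus θ) where
  one_smul a := by ext; simp [coeff_smul]
  mul_smul c d a := by ext; simp [coeff_smul, mul_assoc]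
  smul_zero c := by ext; simp [coeff_smul, coeff_zero]
  smul_add c a b := by ext; simp [coeff_smul, coeff_add, mul_add]
  add_smul c d a := by ext; simp [coeff_smul, coeff_add, add_mul]
  zero_smul a := by ext; simp [coeff_smul, coeff_zero]

instance : Algebra ℂ (SmoothTorus θ) :=
  Algebra.ofModule
    (fun c a b => by
      ext z
      simp only [coeff_mul, coeff_smul, twistedConv, Pi.smul_apply, smul_eq_mul, ← tsum_mul_left]
      exact tsum_congr fun x => by ring)
    (fun c a b => by
      ext z
      simp only [coeff_mul, coeff_smul, twistedConv, Pi.smul_apply, smul_eq_mul, ← tsum_mul_left]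
      exact tsum_congr fun x => by ring)

/-- The monomial `U₁ⁿ U₂ᵐ`, for `x = (n, m)`. -/
def monomial (x : ℤ × ℤ) : SmoothTorus θ := ⟨Pi.single x 1, rapidDecay_single x 1⟩

lemma monomial_mul_monomial (x y : ℤ × ℤ) :
    (monomial x * monomial y : SmoothTorus θ) = phase θ x y • monomial (x + y) := by
  ext z
  rw [coeff_mul, twistedConv, tsum_eq_single x]
  · by_cases h : z = x + y
    · subst h; simp [monomial, coeff_smul]
    · have h' : z - x ≠ y := fun h' => h (by rw [← h']; abel)
      simp [monomial, coeff_smul, Pi.single_eq_of_ne h, Pi.single_eq_of_ne h']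
  · intro w hw
    simp [monomial, Pi.single_eq_of_ne hw]

/-- The generator `U₁`. -/
def U₁ : SmoothTorus θ := monomial (1, 0)

/-- The generator `U₂`. -/
def U₂ : SmoothTorus θ := monomial (0, 1)

/-- The commutation relation `U₂ U₁ = λ U₁ U₂`, `λ = exp (2 π i θ)`. -/
lemma U₂_mul_U₁ :
    (U₂ * U₁ : SmoothTorus θ) = Complex.exp (2 * Real.pi * Complex.I * θ) • (U₁ * U₂) := by
  simp [U₁, U₂, monomial_mul_monomial, phase]

/-- The normalized trace `τ (∑ s_{n,m} U₁ⁿ U₂ᵐ) = s_{0,0}`. -/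
def trace (a : SmoothTorus θ) : ℂ := a.coeff 0

/-- The derivation `δ_X = X₁ δ₁ + X₂ δ₂` attached to `X = (X₁, X₂)` in the (abelian) Lie algebra
`ℝ²` of `𝕋²`, where `δ_k (U_k) = 2 π i U_k` and `δ_j (U_k) = 0` for `j ≠ k`; thus
`δ_X (U₁ⁿ U₂ᵐ) = 2 π i (n X₁ + m X₂) U₁ⁿ U₂ᵐ`. -/
def delta (X : Fin 2 → ℝ) (a : SmoothTorus θ) : SmoothTorus θ where
  coeff x := 2 * Real.pi * Complex.I * (x.1 * X 0 + x.2 * X 1) * a.coeff x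
  rapidDecay := by
    intro k
    obtain ⟨C, hC⟩ := a.rapidDecay (k + 1)
    refine ⟨2 * Real.pi * (|X 0| + |X 1|) * C, fun x => ?_⟩
    have hw := weight_pos x
    have h1 : ‖((x.1 * X 0 + x.2 * X 1 : ℝ) : ℂ)‖ ≤ (|X 0| + |X 1|) * weight x := by
      rw [Complex.norm_real, Real.norm_eq_abs]
      refine (abs_add_le _ _).trans ?_
      rw [abs_mul, abs_mul]
      unfold weight
      have a1 := abs_nonneg (x.1 : ℝ)
      have a2 := abs_nonneg (x.2 : ℝ)
      have b1 := abs_nonneg (X 0)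
      have b2 := abs_nonneg (X 1)
      nlinarith [mul_nonneg a1 b1, mul_nonneg a1 b2, mul_nonneg a2 b1, mul_nonneg a2 b2]
    have h2 : ‖(2 * Real.pi * Complex.I : ℂ)‖ = 2 * Real.pi := by
      simp [abs_of_pos Real.pi_pos]
    have h3 : ((x.1 * X 0 + x.2 * X 1 : ℝ) : ℂ) = (x.1 * X 0 + x.2 * X 1 : ℂ) := by push_cast; rfl
    rw [h3] at h1
    rw [norm_mul, norm_mul, h2]
    have hpi := Real.pi_pos
    calc weight x ^ k * (2 * Real.pi * ‖(x.1 * X 0 + x.2 * X 1 : ℂ)‖ * ‖a.coeff x‖)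
        ≤ weight x ^ k * (2 * Real.pi * ((|X 0| + |X 1|) * weight x) * ‖a.coeff x‖) := by gcongr
      _ = 2 * Real.pi * (|X 0| + |X 1|) * (weight x ^ (k + 1) * ‖a.coeff x‖) := by ring
      _ ≤ _ := by gcongr; exact hC x

lemma delta_comm (X Y : Fin 2 → ℝ) (a : SmoothTorus θ) :
    delta X (delta Y a) = delta Y (delta X a) := by
  ext x
  simp only [delta]
  ring

end SmoothTorus

/-- Two unitaries `W₁`, `W₂` of `ℂ^q` with `W₁ W₂ = exp (2 π i / q) W₂ W₁`. -/
structure WeylPair (q : ℕ) where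
  W₁ : Matrix.unitaryGroup (Fin q) ℂ
  W₂ : Matrix.unitaryGroup (Fin q) ℂ
  comm : (W₁ : Matrix (Fin q) (Fin q) ℂ) * (W₂ : Matrix (Fin q) (Fin q) ℂ) =
    Complex.exp (2 * Real.pi * Complex.I / q) •
      ((W₂ : Matrix (Fin q) (Fin q) ℂ) * (W₁ : Matrix (Fin q) (Fin q) ℂ))

/-- The shift `ε = p / q - θ`. -/
def eps (θ : ℝ) (p : ℤ) (q : ℕ) : ℝ := p / q - θ

section Weyl

variable {q : ℕ}

/-- The scalar unitary `exp (i t)`. -/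
def scalarUnitary (q : ℕ) (t : ℝ) : Matrix.unitaryGroup (Fin q) ℂ :=
  ⟨Complex.exp (t * Complex.I) • 1, by
    rw [Matrix.mem_unitaryGroup_iff, star_smul, star_one, smul_mul_smul_comm, mul_one,
      Complex.star_def, Complex.mul_conj, Complex.normSq_eq_norm_sq,
      Complex.norm_exp_ofReal_mul_I]
    simp⟩

lemma scalarUnitary_commute (t : ℝ) (V : Matrix.unitaryGroup (Fin q) ℂ) :
    Commute (scalarUnitary q t) V := by
  apply Subtype.ext
  simp [scalarUnitary]

lemma scalarUnitary_add (s t : ℝ) :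
    scalarUnitary q (s + t) = scalarUnitary q s * scalarUnitary q t := by
  apply Subtype.ext
  simp [scalarUnitary, smul_smul, ← Complex.exp_add, add_mul, add_comm]

/-- `exp (i t)` as a homomorphism to the scalar unitaries. -/
def scalarUnitaryHom (q : ℕ) : Multiplicative ℝ →* Matrix.unitaryGroup (Fin q) ℂ where
  toFun t := scalarUnitary q t.toAdd
  map_one' := by apply Subtype.ext; simp [scalarUnitary]
  map_mul' s t := scalarUnitary_add _ _

lemma scalarUnitary_zpow (t : ℝ) (n : ℤ) : scalarUnitary q t ^ n = scalarUnitary q (n * t) := by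
  have h := (scalarUnitaryHom q).map_zpow (Multiplicative.ofAdd t) n
  simp only [scalarUnitaryHom, MonoidHom.coe_mk, OneHom.coe_mk, toAdd_zpow, toAdd_ofAdd,
    zsmul_eq_mul] at h
  exact h.symm

namespace WeylPair

variable (W : WeylPair q)

lemma comm_unitary : W.W₁ * W.W₂ = scalarUnitary q (2 * Real.pi / q) * W.W₂ * W.W₁ := by
  apply Subtype.ext
  have h := W.comm
  simp only [Submonoid.coe_mul, scalarUnitary, smul_mul_assoc, one_mul]
  rw [h]
  congr 2
  push_cast
  ring

lemma zpow_comm (a b : ℤ) :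
    W.W₁ ^ a * W.W₂ ^ b = scalarUnitary q (a * b * (2 * Real.pi / q)) * W.W₂ ^ b * W.W₁ ^ a := by
  set Z := scalarUnitary q (2 * Real.pi / q)
  have h1 : SemiconjBy W.W₁ W.W₂ (Z * W.W₂) := W.comm_unitary
  have h2 : SemiconjBy W.W₁ (W.W₂ ^ b) (Z ^ b * W.W₂ ^ b) := by
    have := h1.zpow_right b
    rwa [(scalarUnitary_commute _ W.W₂).mul_zpow] at this
  have h3 : SemiconjBy (W.W₂ ^ (-b)) W.W₁ (Z ^ b * W.W₁) := by
    unfold SemiconjBy at h2 ⊢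
    have hc : Commute (W.W₂ ^ (-b)) (Z ^ b) := (scalarUnitary_commute _ W.W₂).symm.zpow_zpow _ _
    calc W.W₂ ^ (-b) * W.W₁ = W.W₂ ^ (-b) * (W.W₁ * W.W₂ ^ b) * W.W₂ ^ (-b) := by
          simp [mul_assoc]
      _ = (W.W₂ ^ (-b) * Z ^ b) * W.W₂ ^ b * W.W₁ * W.W₂ ^ (-b) := by rw [h2]; simp only [mul_assoc]
      _ = _ := by rw [hc.eq]; simp [mul_assoc]
  have h4 := h3.zpow_right a
  rw [((scalarUnitary_commute (q := q) _ W.W₁).zpow_left b).mul_zpow] at h4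
  unfold SemiconjBy at h4
  rw [← zpow_mul, scalarUnitary_zpow] at h4
  have e : ((b * a : ℤ) : ℝ) * (2 * Real.pi / q) = a * b * (2 * Real.pi / q) := by push_cast; ring
  rw [e] at h4
  have hc := scalarUnitary_commute (a * b * (2 * Real.pi / q)) (W.W₂ ^ b)
  calc W.W₁ ^ a * W.W₂ ^ b = W.W₂ ^ b * (W.W₂ ^ (-b) * W.W₁ ^ a) * W.W₂ ^ b := by simp [← mul_assoc]
    _ = _ := by
      rw [h4, hc.eq]
      simp [mul_assoc]

/-- The unitary `W₂^{p m} W₁ⁿ`, for `x = (n, m)`. -/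
def word (p : ℤ) (x : ℤ × ℤ) : Matrix.unitaryGroup (Fin q) ℂ := W.W₂ ^ (p * x.2) * W.W₁ ^ x.1

lemma word_mul_word (p : ℤ) (x y : ℤ × ℤ) :
    W.word p y * W.word p x =
      scalarUnitary q (y.1 * (p * x.2) * (2 * Real.pi / q)) * W.word p (x + y) := by
  have h := W.zpow_comm y.1 (p * x.2)
  have hc := scalarUnitary_commute (y.1 * (p * x.2 : ℤ) * (2 * Real.pi / q)) (W.W₂ ^ (p * y.2))
  unfold word
  calc W.W₂ ^ (p * y.2) * W.W₁ ^ y.1 * (W.W₂ ^ (p * x.2) * W.W₁ ^ x.1)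
      = W.W₂ ^ (p * y.2) * (W.W₁ ^ y.1 * W.W₂ ^ (p * x.2)) * W.W₁ ^ x.1 := by
        simp only [mul_assoc]
    _ = _ := by
        rw [h]
        simp only [← mul_assoc]
        rw [← hc.eq]
        simp only [Prod.fst_add, Prod.snd_add, mul_add, zpow_add, mul_assoc, Int.cast_mul]
        rw [(Commute.refl W.W₁).zpow_zpow y.1 x.1 |>.eq,
          ← mul_assoc (W.W₂ ^ (p * y.2)), (Commute.refl W.W₂).zpow_zpow (p * y.2) (p * x.2) |>.eq,
          mul_assoc]

end WeylPair

/-- The operator `ξ ↦ (ξ · U₁ⁿ) · U₂ᵐ`, for `x = (n, m)`, on functions with values in `ℂ^q`: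
it sends `ξ` to `s ↦ exp (2 π i m s) W₂^{p m} W₁ⁿ ξ (s - n ε)`. -/
def weylShift (θ : ℝ) (p : ℤ) (W : WeylPair q) (x : ℤ × ℤ) (ξ : ℝ → Fin q → ℂ) (s : ℝ) :
    Fin q → ℂ :=
  Complex.exp (2 * Real.pi * Complex.I * x.2 * s) •
    ((W.word p x : Matrix (Fin q) (Fin q) ℂ).mulVec (ξ (s - x.1 * eps θ p q)))

lemma weylShift_weylShift [NeZero q] (θ : ℝ) (p : ℤ) (W : WeylPair q) (x y : ℤ × ℤ)
    (ξ : ℝ → Fin q → ℂ) (s : ℝ) :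
    weylShift θ p W y (weylShift θ p W x ξ) s =
      phase θ x y • weylShift θ p W (x + y) ξ s := by
  have hq : (q : ℂ) ≠ 0 := Nat.cast_ne_zero.mpr (NeZero.ne q)
  have h := congrArg (Subtype.val) (W.word_mul_word p x y)
  simp only [Submonoid.coe_mul, scalarUnitary, smul_mul_assoc, one_mul] at h
  unfold weylShift
  rw [Matrix.mulVec_smul, Matrix.mulVec_mulVec, h, Matrix.smul_mulVec, smul_smul, smul_smul,
    smul_smul]
  have e1 : s - y.1 * eps θ p q - x.1 * eps θ p q = s - ((x + y).1 : ℤ) * eps θ p q := by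
    simp only [Prod.fst_add]; push_cast; ring
  rw [e1]
  congr 1
  unfold phase
  simp only [← Complex.exp_add]
  congr 1
  simp only [Prod.snd_add, eps]
  push_cast
  field_simp
  ring

lemma norm_weylShift_le (θ : ℝ) (p : ℤ) (W : WeylPair q) (x : ℤ × ℤ) (ξ : ℝ → Fin q → ℂ) (s : ℝ) :
    ‖weylShift θ p W x ξ s‖ ≤ q * ‖ξ (s - x.1 * eps θ p q)‖ := by
  have e : Complex.exp (2 * Real.pi * Complex.I * x.2 * s) =
      Complex.exp (((2 * Real.pi * x.2 * s : ℝ) : ℂ) * Complex.I) := by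
    congr 1; push_cast; ring
  unfold weylShift
  rw [norm_smul, e, Complex.norm_exp_ofReal_mul_I, one_mul,
    pi_norm_le_iff_of_nonneg (by positivity)]
  intro i
  set v := ξ (s - x.1 * eps θ p q)
  calc ‖((W.word p x : Matrix (Fin q) (Fin q) ℂ).mulVec v) i‖
      ≤ ∑ j, ‖(W.word p x : Matrix (Fin q) (Fin q) ℂ) i j * v j‖ := by
        rw [Matrix.mulVec, dotProduct]
        exact norm_sum_le _ _
    _ ≤ ∑ _j : Fin q, ‖v‖ := by
        refine Finset.sum_le_sum fun j _ => ?_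
        rw [norm_mul]
        have h1 := entry_norm_bound_of_unitary (W.word p x).2 i j
        have h2 := norm_le_pi_norm v j
        calc _ ≤ 1 * ‖v‖ := by gcongr
          _ = ‖v‖ := one_mul _
    _ = q * ‖v‖ := by simp

lemma contDiff_weylShift (θ : ℝ) (p : ℤ) (W : WeylPair q) (x : ℤ × ℤ) {ξ : ℝ → Fin q → ℂ}
    (hξ : ContDiff ℝ ∞ ξ) : ContDiff ℝ ∞ (weylShift θ p W x ξ) := by
  unfold weylShift
  have h1 : ContDiff ℝ ∞ (fun s : ℝ => Complex.exp (2 * Real.pi * Complex.I * x.2 * s)) :=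
    (contDiff_const.mul Complex.ofRealCLM.contDiff).cexp
  have h2 : ContDiff ℝ ∞ (fun s : ℝ => ξ (s - x.1 * eps θ p q)) :=
    hξ.comp (contDiff_id.sub contDiff_const)
  have h3 := ((Matrix.mulVecLin
    (W.word p x : Matrix (Fin q) (Fin q) ℂ)).restrictScalars ℝ).toContinuousLinearMap.contDiff
      (n := ∞)
  exact h1.smul (h3.comp h2)

lemma deriv_weylShift (θ : ℝ) (p : ℤ) (W : WeylPair q) (x : ℤ × ℤ) {ξ : ℝ → Fin q → ℂ}
    (hξ : ContDiff ℝ ∞ ξ) :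
    deriv (weylShift θ p W x ξ) =
      (2 * Real.pi * Complex.I * x.2 : ℂ) • weylShift θ p W x ξ + weylShift θ p W x (deriv ξ) := by
  funext s
  have h1 : HasDerivAt (fun s : ℝ => Complex.exp (2 * Real.pi * Complex.I * x.2 * s))
      (Complex.exp (2 * Real.pi * Complex.I * x.2 * s) * (2 * Real.pi * Complex.I * x.2 * 1)) s :=
    ((Complex.ofRealCLM.hasDerivAt (x := s)).const_mul _).cexp
  have h2 : HasDerivAt (fun s : ℝ => ξ (s - x.1 * eps θ p q))
      (deriv ξ (s - x.1 * eps θ p q)) s := by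
    have hd : HasDerivAt ξ (deriv ξ (s - x.1 * eps θ p q)) (s - x.1 * eps θ p q) :=
      (hξ.differentiable (by simp)).differentiableAt.hasDerivAt
    exact hd.comp_sub_const s _
  have h3 := ((Matrix.mulVecLin
    (W.word p x : Matrix (Fin q) (Fin q) ℂ)).restrictScalars ℝ).toContinuousLinearMap.hasFDerivAt
      (x := ξ (s - x.1 * eps θ p q)) |>.comp_hasDerivAt s h2
  have h4 := (h1.smul h3).deriv
  refine Eq.trans h4 ?_
  simp only [Pi.add_apply, Pi.smul_apply, weylShift, smul_smul, mul_one]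
  rw [add_comm]
  congr 1
  rw [mul_comm]
  rfl

lemma weylShift_bound (θ : ℝ) (p : ℤ) (W : WeylPair q) (k l : ℕ) (ξ : 𝓢(ℝ, Fin q → ℂ)) :
    ∃ C : ℝ, 0 ≤ C ∧ ∃ N : ℕ, ∀ (x : ℤ × ℤ) (s : ℝ),
      ‖s‖ ^ k * ‖iteratedDeriv l (weylShift θ p W x ξ) s‖ ≤ C * weight x ^ N := by
  induction l generalizing ξ with
  | zero =>
    obtain ⟨C₀, hC₀, h₀⟩ := ξ.decay 0 0
    obtain ⟨C₁, hC₁, h₁⟩ := ξ.decay k 0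
    refine ⟨q * (2 ^ k * ((1 + |eps θ p q|) ^ k * C₀ + C₁)), by positivity, k, fun x s => ?_⟩
    rw [iteratedDeriv_zero]
    set t := s - x.1 * eps θ p q with ht
    have hw := one_le_weight x
    have g0 : ‖ξ t‖ ≤ C₀ := by simpa using h₀ t
    have g1 : ‖t‖ ^ k * ‖ξ t‖ ≤ C₁ := by simpa using h₁ t
    have hn : |(x.1 : ℝ)| ≤ weight x := by
      unfold weight
      have := abs_nonneg (x.2 : ℝ)
      linarith
    have hs : ‖s‖ ≤ (1 + |eps θ p q|) * weight x + ‖t‖ := by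
      have : s = x.1 * eps θ p q + t := by rw [ht]; ring
      calc ‖s‖ ≤ ‖(x.1 * eps θ p q : ℝ)‖ + ‖t‖ := by
            conv_lhs => rw [this]
            exact norm_add_le _ _
        _ ≤ _ := by
            gcongr
            rw [Real.norm_eq_abs, abs_mul, mul_comm]
            gcongr
            linarith
    have hs' : ‖s‖ ^ k ≤ 2 ^ k * (((1 + |eps θ p q|) * weight x) ^ k + ‖t‖ ^ k) := by
      calc ‖s‖ ^ k ≤ ((1 + |eps θ p q|) * weight x + ‖t‖) ^ k := by gcongr
        _ ≤ 2 ^ (k - 1) * (((1 + |eps θ p q|) * weight x) ^ k + ‖t‖ ^ k) :=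
            add_pow_le (by positivity) (norm_nonneg _) k
        _ ≤ _ := by
            gcongr
            · norm_num
            · omega
    calc ‖s‖ ^ k * ‖weylShift θ p W x ξ s‖
        ≤ (2 ^ k * (((1 + |eps θ p q|) * weight x) ^ k + ‖t‖ ^ k)) * (q * ‖ξ t‖) := by
          gcongr; exact norm_weylShift_le θ p W x ξ s
      _ = q * (2 ^ k * ((1 + |eps θ p q|) ^ k * weight x ^ k * ‖ξ t‖ + ‖t‖ ^ k * ‖ξ t‖)) := by
          rw [mul_pow]; ring
      _ ≤ q * (2 ^ k * ((1 + |eps θ p q|) ^ k * weight x ^ k * C₀ + C₁ * weight x ^ k)) := by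
          have : C₁ ≤ C₁ * weight x ^ k := le_mul_of_one_le_right hC₁.le (one_le_pow₀ hw)
          have g2 := g1.trans this
          gcongr
      _ = _ := by ring
  | succ l ih =>
    obtain ⟨C, hC, N, h⟩ := ih ξ
    obtain ⟨D, hD, M, h'⟩ := ih (SchwartzMap.derivCLM ℂ (Fin q → ℂ) ξ)
    refine ⟨2 * Real.pi * C + D, by have := Real.pi_pos; positivity, N + M + 1, fun x s => ?_⟩
    have hw := one_le_weight x
    have hξ : ContDiff ℝ ∞ ξ := ξ.smooth'
    have c1 : ContDiff ℝ ∞ (weylShift θ p W x ξ) := contDiff_weylShift θ p W x hξ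
    have c2 : ContDiff ℝ ∞ (weylShift θ p W x (deriv ξ)) :=
      contDiff_weylShift θ p W x (SchwartzMap.derivCLM ℂ (Fin q → ℂ) ξ).smooth'
    have hl : ((l : ℕ) : WithTop ℕ∞) ≤ ∞ := by exact_mod_cast le_top
    have c1' := (c1.of_le hl).contDiffAt (x := s)
    have c2' := (c2.of_le hl).contDiffAt (x := s)
    have c3 : ContDiffAt ℝ l ((2 * Real.pi * Complex.I * x.2 : ℂ) • weylShift θ p W x ξ) s :=
      c1'.const_smul (2 * Real.pi * Complex.I * x.2 : ℂ)
    rw [iteratedDeriv_succ', deriv_weylShift θ p W x hξ, iteratedDeriv_add c3 c2',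
      iteratedDeriv_const_smul c1']
    have hn : ‖(2 * Real.pi * Complex.I * x.2 : ℂ)‖ ≤ 2 * Real.pi * weight x := by
      simp only [norm_mul, Complex.norm_I, Complex.norm_real, Complex.norm_ofNat, mul_one,
        Complex.norm_intCast, Real.norm_of_nonneg Real.pi_pos.le]
      have := Real.pi_pos
      gcongr
      unfold weight
      have := abs_nonneg (x.1 : ℝ)
      linarith
    have hpi := Real.pi_pos
    have b1 := h x s
    have b2 : ‖s‖ ^ k * ‖iteratedDeriv l (weylShift θ p W x (deriv ξ)) s‖ ≤ D * weight x ^ M :=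
      h' x s
    calc _ ≤ ‖s‖ ^ k * (2 * Real.pi * weight x * ‖iteratedDeriv l (weylShift θ p W x ξ) s‖ +
            ‖iteratedDeriv l (weylShift θ p W x (deriv ξ)) s‖) := by
          gcongr
          refine (norm_add_le _ _).trans ?_
          rw [norm_smul]
          gcongr
      _ = 2 * Real.pi * weight x * (‖s‖ ^ k * ‖iteratedDeriv l (weylShift θ p W x ξ) s‖) +
            ‖s‖ ^ k * ‖iteratedDeriv l (weylShift θ p W x (deriv ξ)) s‖ := by ring
      _ ≤ 2 * Real.pi * weight x * (C * weight x ^ N) + D * weight x ^ M := by gcongr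
      _ = 2 * Real.pi * C * weight x ^ (N + 1) + D * weight x ^ M := by ring
      _ ≤ 2 * Real.pi * C * weight x ^ (N + M + 1) + D * weight x ^ (N + M + 1) := by
          gcongr <;> first | exact hw | omega
      _ = _ := by ring

lemma smul_weylShift_bound (θ : ℝ) (p : ℤ) (W : WeylPair q) {a : ℤ × ℤ → ℂ} (ha : RapidDecay a)
    (k l : ℕ) (ξ : 𝓢(ℝ, Fin q → ℂ)) :
    ∃ v : ℤ × ℤ → ℝ, Summable v ∧ ∀ (x : ℤ × ℤ) (s : ℝ),
      ‖s‖ ^ k * ‖iteratedFDeriv ℝ l (fun s => a x • weylShift θ p W x ξ s) s‖ ≤ v x := by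
  obtain ⟨C, hC, N, h⟩ := weylShift_bound θ p W k l ξ
  refine ⟨fun x => C * (weight x ^ N * ‖a x‖), (ha.summable_weight N).mul_left C, fun x s => ?_⟩
  have hl : ((l : ℕ) : WithTop ℕ∞) ≤ ∞ := by exact_mod_cast le_top
  have c1 := ((contDiff_weylShift θ p W x ξ.smooth').of_le hl).contDiffAt (x := s)
  rw [norm_iteratedFDeriv_eq_norm_iteratedDeriv]
  have : iteratedDeriv l (fun s => a x • weylShift θ p W x ξ s) s =
      a x • iteratedDeriv l (weylShift θ p W x ξ) s := iteratedDeriv_const_smul c1 (a x)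
  rw [this, norm_smul]
  calc _ = ‖a x‖ * (‖s‖ ^ k * ‖iteratedDeriv l (weylShift θ p W x ξ) s‖) := by ring
    _ ≤ ‖a x‖ * (C * weight x ^ N) := mul_le_mul_of_nonneg_left (h x s) (norm_nonneg _)
    _ = _ := by ring

lemma summable_smul_weylShift (θ : ℝ) (p : ℤ) (W : WeylPair q) {a : ℤ × ℤ → ℂ} (ha : RapidDecay a)
    (ξ : 𝓢(ℝ, Fin q → ℂ)) (s : ℝ) : Summable (fun x => a x • weylShift θ p W x ξ s) := by
  obtain ⟨v, hv, h⟩ := smul_weylShift_bound θ p W ha 0 0 ξ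
  exact Summable.of_norm_bounded hv (fun x => by simpa using h x s)

/-- The Schwartz function `ξ · a = ∑ s_{n,m} (ξ · U₁ⁿ) · U₂ᵐ` for `a = ∑ s_{n,m} U₁ⁿ U₂ᵐ`. -/
def act (θ : ℝ) (p : ℤ) (W : WeylPair q) (ξ : 𝓢(ℝ, Fin q → ℂ)) (a : SmoothTorus θ) :
    𝓢(ℝ, Fin q → ℂ) where
  toFun s := ∑' x, a.coeff x • weylShift θ p W x ξ s
  smooth' := by
    choose v hv h using fun l => smul_weylShift_bound θ p W a.rapidDecay 0 l ξ
    exact contDiff_tsum (N := ⊤)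
      (fun x => (contDiff_weylShift θ p W x ξ.smooth').const_smul (a.coeff x))
      (fun l _ => hv l) (fun l x s _ => by simpa using h l x s)
  decay' := by
    intro k l
    choose v hv h using fun l => smul_weylShift_bound θ p W a.rapidDecay 0 l ξ
    obtain ⟨u, hu, h'⟩ := smul_weylShift_bound θ p W a.rapidDecay k l ξ
    refine ⟨∑' x, u x, fun s => ?_⟩
    have hξ : ContDiff ℝ ∞ ξ := ξ.smooth'
    rw [iteratedFDeriv_tsum_apply (N := ⊤) (v := v)
      (fun x => (contDiff_weylShift θ p W x hξ).const_smul (a.coeff x))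
      (fun l _ => hv l) (fun l x s _ => by simpa using h l x s) le_top]
    have hsum : Summable (fun x =>
        ‖iteratedFDeriv ℝ l (fun s => a.coeff x • weylShift θ p W x ξ s) s‖) :=
      Summable.of_nonneg_of_le (fun _ => norm_nonneg _) (fun x => by simpa using h l x s) (hv l)
    calc _ ≤ ‖s‖ ^ k * ∑' x, ‖iteratedFDeriv ℝ l (fun s => a.coeff x • weylShift θ p W x ξ s) s‖ := by
          gcongr; exact norm_tsum_le_tsum_norm hsum
      _ = ∑' x, ‖s‖ ^ k * ‖iteratedFDeriv ℝ l (fun s => a.coeff x • weylShift θ p W x ξ s) s‖ := by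
          rw [tsum_mul_left]
      _ ≤ ∑' x, u x := (hsum.mul_left _).tsum_le_tsum (fun x => h' x s) hu

lemma act_apply (θ : ℝ) (p : ℤ) (W : WeylPair q) (ξ : 𝓢(ℝ, Fin q → ℂ)) (a : SmoothTorus θ)
    (s : ℝ) : act θ p W ξ a s = ∑' x, a.coeff x • weylShift θ p W x ξ s := rfl

lemma weylShift_add (θ : ℝ) (p : ℤ) (W : WeylPair q) (x : ℤ × ℤ) (ξ η : ℝ → Fin q → ℂ) (s : ℝ) :
    weylShift θ p W x (ξ + η) s = weylShift θ p W x ξ s + weylShift θ p W x η s := by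
  simp [weylShift, Matrix.mulVec_add]

lemma weylShift_smul (θ : ℝ) (p : ℤ) (W : WeylPair q) (x : ℤ × ℤ) (c : ℂ) (ξ : ℝ → Fin q → ℂ)
    (s : ℝ) : weylShift θ p W x (c • ξ) s = c • weylShift θ p W x ξ s := by
  simp only [weylShift, Pi.smul_apply, Matrix.mulVec_smul]
  rw [smul_comm]

lemma weylShift_zero (θ : ℝ) (p : ℤ) (W : WeylPair q) (ξ : ℝ → Fin q → ℂ) (s : ℝ) :
    weylShift θ p W 0 ξ s = ξ s := by
  simp [weylShift, WeylPair.word]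

lemma weylShift_tsum (θ : ℝ) (p : ℤ) (W : WeylPair q) (y : ℤ × ℤ) {a : ℤ × ℤ → ℂ}
    (f : ℤ × ℤ → ℝ → Fin q → ℂ) (hf : ∀ s, Summable (fun x => a x • f x s)) (s : ℝ) :
    weylShift θ p W y (fun s => ∑' x, a x • f x s) s =
      ∑' x, a x • weylShift θ p W y (f x) s := by
  let L : (Fin q → ℂ) →L[ℂ] (Fin q → ℂ) :=
    (Complex.exp (2 * Real.pi * Complex.I * y.2 * s) •
      Matrix.mulVecLin (W.word p y : Matrix (Fin q) (Fin q) ℂ)).toContinuousLinearMap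
  have h := L.map_tsum (hf (s - y.1 * eps θ p q))
  simp only [map_smul] at h
  exact h

lemma act_mul [NeZero q] (θ : ℝ) (p : ℤ) (W : WeylPair q) (ξ : 𝓢(ℝ, Fin q → ℂ))
    (a b : SmoothTorus θ) : act θ p W ξ (a * b) = act θ p W (act θ p W ξ a) b := by
  ext1 s
  obtain ⟨B, hB⟩ := ξ.decay 0 0
  have h := tsum_twistedConv_smul θ a.rapidDecay b.rapidDecay
    (fun z => weylShift θ p W z ξ s) (q * B) (fun z => by
      refine (norm_weylShift_le θ p W z ξ s).trans ?_
      gcongr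
      simpa using hB.2 (s - z.1 * eps θ p q))
  have hs := (Equiv.prodComm (ℤ × ℤ) (ℤ × ℤ)).summable_iff.mpr h.1
  rw [act_apply, act_apply, SmoothTorus.coeff_mul]
  refine h.2.trans ?_
  rw [← (Equiv.prodComm (ℤ × ℤ) (ℤ × ℤ)).tsum_eq]
  refine hs.tsum_prod.trans ?_
  refine tsum_congr fun y => ?_
  have e : (act θ p W ξ a : ℝ → Fin q → ℂ) =
    fun s => ∑' x, a.coeff x • weylShift θ p W x ξ s := rfl
  rw [e, weylShift_tsum θ p W y (fun x => weylShift θ p W x ξ)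
    (summable_smul_weylShift θ p W a.rapidDecay ξ) s]
  have hsum : Summable (fun x =>
      a.coeff x • weylShift θ p W y (weylShift θ p W x ξ) s) := by
    refine Summable.of_norm_bounded (a.rapidDecay.summable_norm.mul_right (q * (q * B)))
      (fun x => ?_)
    rw [norm_smul]
    gcongr
    refine (norm_weylShift_le θ p W y _ s).trans ?_
    gcongr
    refine (norm_weylShift_le θ p W x _ _).trans ?_
    gcongr
    simpa using hB.2 _
  rw [← hsum.tsum_const_smul]
  refine tsum_congr fun x => ?_
  simp only [Function.comp_apply, Equiv.prodComm_apply, Prod.swap_prod_mk,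
    weylShift_weylShift, smul_smul]
  congr 1
  ring

end Weyl

/-- The module `Ξ_{p,q}^∞`: the space `𝓢(ℝ) ⊗ ℂ^q` of Schwartz functions on `ℝ` with values in
`ℂ^q`. It depends on `θ`, `p` and the pair `W` only through its right module structure, given
below. -/
def Xi (_θ : ℝ) (_p : ℤ) {q : ℕ} (_W : WeylPair q) : Type := 𝓢(ℝ, Fin q → ℂ)

namespace Xi

variable {θ : ℝ} {p : ℤ} {q : ℕ} {W : WeylPair q}

instance : AddCommGroup (Xi θ p W) := inferInstanceAs (AddCommGroup 𝓢(ℝ, Fin q → ℂ))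

instance : Module ℂ (Xi θ p W) := inferInstanceAs (Module ℂ 𝓢(ℝ, Fin q → ℂ))

instance : FunLike (Xi θ p W) ℝ (Fin q → ℂ) :=
  inferInstanceAs (FunLike 𝓢(ℝ, Fin q → ℂ) ℝ (Fin q → ℂ))

lemma add_apply (ξ η : Xi θ p W) (s : ℝ) : (ξ + η) s = ξ s + η s := rfl
lemma smul_apply (c : ℂ) (ξ : Xi θ p W) (s : ℝ) : (c • ξ) s = c • ξ s := rfl
lemma zero_apply (s : ℝ) : (0 : Xi θ p W) s = 0 := rfl
lemma coe_add (ξ η : Xi θ p W) : ⇑(ξ + η) = ⇑ξ + ⇑η := rfl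
lemma coe_smul (c : ℂ) (ξ : Xi θ p W) : ⇑(c • ξ) = c • ⇑ξ := rfl

/-- Right multiplication by elements of `A_θ^∞`; as usual, a right module over `A` is a module over
the opposite ring of `A`, and `MulOpposite.op a • ξ` is `ξ · a`. -/
instance : SMul (SmoothTorus θ)ᵐᵒᵖ (Xi θ p W) := ⟨fun a ξ => act θ p W ξ a.unop⟩

lemma op_smul_apply (a : (SmoothTorus θ)ᵐᵒᵖ) (ξ : Xi θ p W) (s : ℝ) :
    (a • ξ) s = ∑' x, a.unop.coeff x • weylShift θ p W x ξ s := rfl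

lemma summable (a : SmoothTorus θ) (ξ : Xi θ p W) (s : ℝ) :
    Summable (fun x => a.coeff x • weylShift θ p W x ξ s) :=
  summable_smul_weylShift θ p W a.rapidDecay ξ s

instance [NeZero q] : Module (SmoothTorus θ)ᵐᵒᵖ (Xi θ p W) where
  one_smul ξ := by
    apply DFunLike.ext
    intro s
    rw [op_smul_apply, tsum_eq_single 0]
    · simp [SmoothTorus.coeff_one, weylShift_zero]
    · intro x hx
      simp [SmoothTorus.coeff_one, Pi.single_eq_of_ne hx]
  mul_smul a b ξ := act_mul θ p W ξ b.unop a.unop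
  smul_zero a := by
    apply DFunLike.ext
    intro s
    have h : ⇑(0 : Xi θ p W) = (0 : ℂ) • (0 : ℝ → Fin q → ℂ) := by
      funext t; simp [zero_apply]
    rw [op_smul_apply, h]
    simp only [weylShift_smul]
    simp
  smul_add a ξ η := by
    apply DFunLike.ext
    intro s
    simp only [op_smul_apply, add_apply, coe_add, weylShift_add, smul_add]
    exact (summable a.unop ξ s).tsum_add (summable a.unop η s)
  add_smul a b ξ := by
    apply DFunLike.ext
    intro s
    simp only [op_smul_apply, add_apply, MulOpposite.unop_add, SmoothTorus.coeff_add, Pi.add_apply,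
      add_smul]
    exact (summable a.unop ξ s).tsum_add (summable b.unop ξ s)
  zero_smul ξ := by
    apply DFunLike.ext
    intro s
    simp [op_smul_apply, SmoothTorus.coeff_zero, zero_apply]

instance [NeZero q] : IsScalarTower ℂ (SmoothTorus θ)ᵐᵒᵖ (Xi θ p W) where
  smul_assoc c a ξ := by
    apply DFunLike.ext
    intro s
    simp only [op_smul_apply, smul_apply, MulOpposite.unop_smul, SmoothTorus.coeff_smul,
      Pi.smul_apply, smul_assoc]
    exact (summable a.unop ξ s).tsum_const_smul c

end Xi

section Modules

open MulOpposite (op)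

variable {θ : ℝ}

/-- The right module `e A^n` for an idempotent `e ∈ M_n (A)`, `A = A_θ^∞`: the vectors `v ∈ A^n`
with `e v = v`. -/
def idemModule {n : ℕ} (e : Matrix (Fin n) (Fin n) (SmoothTorus θ)) :
    Submodule (SmoothTorus θ)ᵐᵒᵖ (Fin n → SmoothTorus θ) where
  carrier := {v | e.mulVec v = v}
  add_mem' {v w} hv hw := by
    simp only [Set.mem_ofPred_eq] at *
    rw [Matrix.mulVec_add, hv, hw]
  zero_mem' := Matrix.mulVec_zero e
  smul_mem' a v hv := by
    simp only [Set.mem_ofPred_eq] at *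
    rw [Matrix.mulVec_smul, hv]

/-- The trace `τ ⊗ Tr` on `M_n (A_θ^∞)`. -/
def matrixTrace {n : ℕ} (x : Matrix (Fin n) (Fin n) (SmoothTorus θ)) : ℂ :=
  ∑ i, (x i i).trace

variable (θ) (M : Type) [AddCommGroup M] [Module ℂ M] [Module (SmoothTorus θ)ᵐᵒᵖ M]

/-- The right `A_θ^∞`-module `M` is isomorphic to `e A^n` for some idempotent `e ∈ M_n (A)`
with `(τ ⊗ Tr) (e) = d`: it is finite projective of dimension `d`. -/
def HasDimension (d : ℝ) : Prop :=
  ∃ (n : ℕ) (e : Matrix (Fin n) (Fin n) (SmoothTorus θ)),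
    e * e = e ∧ Nonempty (M ≃ₗ[(SmoothTorus θ)ᵐᵒᵖ] idemModule e) ∧ matrixTrace e = d

variable {θ M}

/-- The trace of the endomorphism `T` of the finite projective module `M` is `t`:
identifying `M` with `e A^n` and `End (e A^n)` with `e M_n (A) e`, the trace `τ ⊗ Tr` of the
element `x` of `e M_n (A) e` corresponding to `T` is `t`. -/
def HasEndTrace (T : Module.End (SmoothTorus θ)ᵐᵒᵖ M) (t : ℂ) : Prop :=
  ∃ (n : ℕ) (e x : Matrix (Fin n) (Fin n) (SmoothTorus θ))
    (Φ : M ≃ₗ[(SmoothTorus θ)ᵐᵒᵖ] idemModule e),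
    e * e = e ∧ e * x * e = x ∧
      (∀ ξ : M, (Φ (T ξ) : Fin n → SmoothTorus θ) = x.mulVec (Φ ξ : Fin n → SmoothTorus θ)) ∧
      matrixTrace x = t

variable (θ M) in
/-- A connection on the right `A_θ^∞`-module `M`: a linear map `X ↦ ∇_X` from the Lie algebra `ℝ²`
of `𝕋²` to the linear operators on `M` with
`∇_X (ξ · a) = ∇_X (ξ) · a + ξ · δ_X (a)`. -/
structure Connection where
  toLinearMap : (Fin 2 → ℝ) →ₗ[ℝ] (M →ₗ[ℂ] M)
  leibniz : ∀ (X : Fin 2 → ℝ) (ξ : M) (a : SmoothTorus θ),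
    toLinearMap X (op a • ξ) = op a • toLinearMap X ξ + op (a.delta X) • ξ

/-- The curvature `Θ (X, Y) = ∇_X ∇_Y - ∇_Y ∇_X - ∇_{[X, Y]}`, an endomorphism of the module; the
last term vanishes since the Lie algebra of `𝕋²` is abelian. -/
def Connection.curvature (D : Connection θ M) (X Y : Fin 2 → ℝ) :
    Module.End (SmoothTorus θ)ᵐᵒᵖ M where
  toFun ξ := D.toLinearMap X (D.toLinearMap Y ξ) - D.toLinearMap Y (D.toLinearMap X ξ)
  map_add' ξ η := by simp only [map_add]; abel
  map_smul' a ξ := by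
    obtain ⟨a, rfl⟩ := MulOpposite.op_surjective a
    simp only [D.leibniz, map_add, RingHom.id_apply, smul_sub, SmoothTorus.delta_comm X Y a]
    abel

/-- The total curvature (the integral of the curvature) of a connection on a finite projective
module is `c`: the number `(2 π i)⁻¹ τ (Θ (X₁, X₂))`, for the standard basis `X₁`, `X₂` of
`ℝ²`, equals `c`. -/
def Connection.HasTotalCurvature (D : Connection θ M) (c : ℝ) : Prop :=
  HasEndTrace (D.curvature ![1, 0] ![0, 1]) (2 * Real.pi * Complex.I * c)

end Modules

end NCTorus

end

open NCTorus

/-!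
The Schwartz module `Ξ = 𝓢(ℝ) ⊗ ℂ^q` carries an `A_θ^∞`-valued inner product. The coefficient of
`U₁ⁿ U₂ᵐ` in `⟨η, ζ⟩` is the `L²` inner product of `η · U₁ⁿ U₂ᵐ` with `ζ`, so that
`τ ⟨η, ζ⟩ = (η, ζ)`. The operators `∇₁`, `∇₂` satisfy the Leibniz rule and are skew-adjoint for the
`L²` inner product; hence multiplying a coefficient of `⟨η, ζ⟩` by `2 π i n` or `2 π i m` amounts to
applying `∇₁` or `∇₂` to the two arguments, and as every coefficient is bounded they decay rapidly
(`Xi.rapidDecay_innerCoeff`). Since the monomials act isometrically, `ζ ↦ ⟨η, ζ⟩` is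
`A_θ^∞`-linear (`Xi.torusInner`).

For `f`, `g` in `𝓢(ℝ)`, the operator `ζ ↦ ∑ⱼ (f ⊗ eⱼ) · ⟨g ⊗ eⱼ, ζ⟩` can be computed: the sum
over `j` removes the unitaries `W₂^{pm} W₁ⁿ`, because a unitary maps the standard basis of `ℂ^q` to an
orthonormal basis, and the sum over `m` is then a Poisson summation. The result is
`ζ ↦ ∑ₙ ∑ₖ f (s - n ε) conj (g (s - n ε + k)) ζ (s + k)`. If `g` is `1` on the support of `f` and is
supported in an interval of length `1`, only `k = 0` contributes, and the operator is
the multiplication by `∑ₙ f (s - n ε)` (`Xi.sum_op_torusInner_smul`). It remains to take finitely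
many functions `fᵢ` of small support whose translates by the multiples of `ε ≠ 0` form a partition
of unity of `ℝ` (`exists_schwartz_partition`). The vectors `fᵢ ⊗ eⱼ` and the functionals
`⟨gᵢ ⊗ eⱼ, ·⟩` are a frame of `Ξ`. A frame identifies a module with `e A^n`, `e` the matrix of the
functionals evaluated at the vectors (`Frame.equivIdemModule`), and here
`(τ ⊗ Tr) e = q ∑ᵢ ∫ fᵢ = q |ε| = |p - q θ|` (`Xi.exists_frame`). The curvature being the scalar
`2 π i / (θ - p / q)`, its trace is this scalar times `(τ ⊗ Tr) e`.
-/

noncomputable section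

namespace NCTorus

/-! ### The connection -/

namespace SmoothTorus

variable {θ : ℝ}

lemma delta_monomial (X : Fin 2 → ℝ) (x : ℤ × ℤ) :
    delta X (monomial x : SmoothTorus θ) =
      (2 * Real.pi * Complex.I * (x.1 * X 0 + x.2 * X 1) : ℂ) • monomial x := by
  ext y
  by_cases h : y = x
  · subst h; simp [delta, monomial, coeff_smul]
  · simp [delta, monomial, coeff_smul, Pi.single_eq_of_ne h]

end SmoothTorus

namespace Xi

open MulOpposite (op)

variable {θ : ℝ} {p : ℤ} {q : ℕ} {W : WeylPair q}

lemma sum_apply {ι : Type*} (t : Finset ι) (f : ι → Xi θ p W) (s : ℝ) :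
    (∑ i ∈ t, f i) s = ∑ i ∈ t, f i s :=
  map_sum (AddMonoidHom.mk' (fun ξ : Xi θ p W => ξ s) fun ξ η => add_apply ξ η s) f t

lemma contDiff (ξ : Xi θ p W) : ContDiff ℝ ∞ ξ :=
  SchwartzMap.smooth' (E := ℝ) (F := Fin q → ℂ) ξ

lemma integrable (ξ : Xi θ p W) : MeasureTheory.Integrable ξ :=
  SchwartzMap.integrable (D := ℝ) (V := Fin q → ℂ) (f := ξ)

lemma exists_norm_le (ξ : Xi θ p W) : ∃ B : ℝ, 0 < B ∧ ∀ s, ‖ξ s‖ ≤ B := by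
  obtain ⟨B, hB, h⟩ := SchwartzMap.decay (E := ℝ) (F := Fin q → ℂ) ξ 0 0
  refine ⟨B, hB, fun s => ?_⟩
  have := h s
  rw [pow_zero, one_mul, norm_iteratedFDeriv_zero] at this
  exact this

lemma act_apply (a : SmoothTorus θ) (ξ : Xi θ p W) (s : ℝ) :
    (op a • ξ) s = ∑' x, a.coeff x • weylShift θ p W x ξ s := rfl

lemma op_smul_monomial (ξ : Xi θ p W) (x : ℤ × ℤ) (s : ℝ) :
    (op (SmoothTorus.monomial x : SmoothTorus θ) • ξ) s = weylShift θ p W x ξ s := by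
  rw [op_smul_apply, tsum_eq_single x]
  · simp [SmoothTorus.monomial]
  · intro y hy
    simp [SmoothTorus.monomial, Pi.single_eq_of_ne hy]

lemma op_smul_U₁ (ξ : Xi θ p W) (s : ℝ) :
    (op (SmoothTorus.U₁ : SmoothTorus θ) • ξ) s =
      (W.W₁ : Matrix (Fin q) (Fin q) ℂ).mulVec (ξ (s - eps θ p q)) := by
  rw [SmoothTorus.U₁, op_smul_monomial]
  simp [weylShift, WeylPair.word]

lemma op_smul_U₂ (ξ : Xi θ p W) (s : ℝ) :
    (op (SmoothTorus.U₂ : SmoothTorus θ) • ξ) s = Complex.exp (2 * Real.pi * Complex.I * s) •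
      ((W.W₂ ^ p : Matrix.unitaryGroup (Fin q) ℂ) : Matrix (Fin q) (Fin q) ℂ).mulVec (ξ s) := by
  rw [SmoothTorus.U₂, op_smul_monomial]
  simp [weylShift, WeylPair.word]

/-- Multiplication by `2 π i s / ε`, the operator `∇₁`. -/
def nabla₁ (θ : ℝ) (p : ℤ) (W : WeylPair q) : Xi θ p W →ₗ[ℂ] Xi θ p W :=
  (SchwartzMap.smulLeftCLM (Fin q → ℂ)
    (fun s : ℝ => (2 * Real.pi * Complex.I * s / eps θ p q : ℂ)) :
      𝓢(ℝ, Fin q → ℂ) →L[ℂ] 𝓢(ℝ, Fin q → ℂ)).toLinearMap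

/-- Differentiation, the operator `∇₂`. -/
def nabla₂ (θ : ℝ) (p : ℤ) (W : WeylPair q) : Xi θ p W →ₗ[ℂ] Xi θ p W :=
  (SchwartzMap.derivCLM ℂ (Fin q → ℂ)).toLinearMap

lemma nabla₁_apply (ξ : Xi θ p W) (s : ℝ) :
    nabla₁ θ p W ξ s = (2 * Real.pi * Complex.I * s / eps θ p q : ℂ) • ξ s := by
  have hg : (fun s : ℝ => (2 * Real.pi * Complex.I * s / eps θ p q : ℂ)).HasTemperateGrowth := by
    have : (fun s : ℝ => (2 * Real.pi * Complex.I * s / eps θ p q : ℂ)) =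
        fun s => (2 * Real.pi * Complex.I / eps θ p q : ℂ) * Complex.ofRealCLM s := by
      funext s; simp; ring
    rw [this]
    fun_prop
  exact SchwartzMap.smulLeftCLM_apply_apply hg (ξ : 𝓢(ℝ, Fin q → ℂ)) s

lemma nabla₂_apply (ξ : Xi θ p W) (s : ℝ) : nabla₂ θ p W ξ s = deriv ξ s := rfl

lemma nabla₁_op_smul (hε : eps θ p q ≠ 0) (ξ : Xi θ p W) (a : SmoothTorus θ) :
    nabla₁ θ p W (op a • ξ) =
      op a • nabla₁ θ p W ξ + op (a.delta ![1, 0]) • ξ := by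
  have hε' : (eps θ p q : ℂ) ≠ 0 := by exact_mod_cast hε
  apply DFunLike.ext
  intro s
  rw [nabla₁_apply, add_apply, act_apply, act_apply, act_apply,
    ← (summable a ξ s).tsum_const_smul,
    ← (summable a (nabla₁ θ p W ξ) s).tsum_add (summable (a.delta ![1, 0]) ξ s)]
  refine tsum_congr fun x => ?_
  simp only [weylShift, nabla₁_apply, SmoothTorus.delta, Matrix.mulVec_smul,
    smul_smul, ← add_smul]
  congr 1
  simp
  field_simp
  ring

lemma nabla₂_op_smul (ξ : Xi θ p W) (a : SmoothTorus θ) :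
    nabla₂ θ p W (op a • ξ) =
      op a • nabla₂ θ p W ξ + op (a.delta ![0, 1]) • ξ := by
  apply DFunLike.ext
  intro s
  rw [nabla₂_apply, add_apply, act_apply, act_apply,
    ← (summable a (nabla₂ θ p W ξ) s).tsum_add (summable (a.delta ![0, 1]) ξ s)]
  -- the series `ξ · a` may be differentiated termwise: the first derivatives are summably bounded
  obtain ⟨v, hv, h⟩ := smul_weylShift_bound θ p W a.rapidDecay 0 1 ξ
  have e : (⇑(op a • ξ) : ℝ → Fin q → ℂ) = fun s => ∑' x, a.coeff x • weylShift θ p W x ξ s :=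
    funext fun s => op_smul_apply _ _ _
  have hd : ∀ x, Differentiable ℝ (weylShift θ p W x ξ) := fun x =>
    (contDiff_weylShift θ p W x ξ.contDiff).differentiable (by simp)
  rw [e, deriv_tsum_apply (g := fun x s => a.coeff x • weylShift θ p W x ξ s) hv
    (fun x => (hd x).const_smul (a.coeff x)) (fun x t => ?_)
    (summable a ξ s) s]
  · refine tsum_congr fun x => ?_
    rw [show (fun s => a.coeff x • weylShift θ p W x ξ s) = a.coeff x • weylShift θ p W x ξ from
        rfl, deriv_const_smul _ (hd x s), deriv_weylShift θ p W x ξ.contDiff]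
    simp only [Pi.add_apply, Pi.smul_apply, smul_add, smul_smul, SmoothTorus.delta]
    rw [add_comm]
    congr 2
    simp
    ring
  · have := h x t
    rw [norm_iteratedFDeriv_eq_norm_iteratedDeriv, iteratedDeriv_one, pow_zero, one_mul] at this
    exact this

variable [NeZero q]

/-- The connection `∇_X = X₁ ∇₁ + X₂ ∇₂`. -/
def connection (hε : eps θ p q ≠ 0) (W : WeylPair q) : Connection θ (Xi θ p W) where
  toLinearMap :=
    { toFun := fun X => (X 0 : ℂ) • nabla₁ θ p W + (X 1 : ℂ) • nabla₂ θ p W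
      map_add' := fun X Y => by
        simp only [Pi.add_apply, Complex.ofReal_add, add_smul]
        abel
      map_smul' := fun c X => by
        simp only [Pi.smul_apply, smul_eq_mul, Complex.ofReal_mul, mul_smul, RingHom.id_apply,
          smul_add]
        rfl }
  leibniz X ξ a := by
    have hδ : a.delta X = (X 0 : ℂ) • a.delta ![1, 0] + (X 1 : ℂ) • a.delta ![0, 1] := by
      ext x
      simp only [SmoothTorus.coeff_add, SmoothTorus.coeff_smul, Pi.add_apply, Pi.smul_apply]
      simp [SmoothTorus.delta]
      ring
    simp only [LinearMap.coe_mk, AddHom.coe_mk, LinearMap.add_apply, LinearMap.smul_apply,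
      nabla₁_op_smul hε, nabla₂_op_smul, hδ, MulOpposite.op_add, MulOpposite.op_smul, add_smul,
      smul_assoc, smul_add]
    rw [smul_comm (op a) (X 0 : ℂ), smul_comm (op a) (X 1 : ℂ)]
    abel

lemma connection_fst (hε : eps θ p q ≠ 0) (W : WeylPair q) :
    (connection hε W).toLinearMap ![1, 0] = nabla₁ θ p W := by
  simp [connection]

lemma connection_snd (hε : eps θ p q ≠ 0) (W : WeylPair q) :
    (connection hε W).toLinearMap ![0, 1] = nabla₂ θ p W := by
  simp [connection]

lemma connection_curvature (hε : eps θ p q ≠ 0) (W : WeylPair q) (ξ : Xi θ p W) :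
    (connection hε W).curvature ![1, 0] ![0, 1] ξ =
      (2 * Real.pi * Complex.I * (1 / (θ - p / q)) : ℂ) • ξ := by
  have h : (connection hε W).curvature ![1, 0] ![0, 1] ξ =
      nabla₁ θ p W (nabla₂ θ p W ξ) - nabla₂ θ p W (nabla₁ θ p W ξ) := by
    rw [← connection_fst hε, ← connection_snd hε]; rfl
  rw [h, sub_eq_iff_eq_add]
  apply DFunLike.ext
  intro s
  have e : (⇑(nabla₁ θ p W ξ) : ℝ → Fin q → ℂ) =
      fun s : ℝ => (2 * Real.pi * Complex.I * s / eps θ p q : ℂ) • ξ s := funext (nabla₁_apply ξ)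
  have h1 : HasDerivAt (fun s : ℝ => (2 * Real.pi * Complex.I * s / eps θ p q : ℂ))
      (2 * Real.pi * Complex.I * 1 / eps θ p q : ℂ) s :=
    ((Complex.ofRealCLM.hasDerivAt (x := s)).const_mul _).div_const _
  have h2 : HasDerivAt ξ (deriv ξ s) s :=
    (ξ.contDiff.differentiable (by simp)).differentiableAt.hasDerivAt
  rw [add_apply, smul_apply, nabla₁_apply, nabla₂_apply, nabla₂_apply, e, (h1.fun_smul h2).deriv]
  have h3 : (θ - p / q : ℂ) = -(eps θ p q : ℂ) := by simp [eps]
  rw [h3]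
  have hε' : (eps θ p q : ℂ) ≠ 0 := by exact_mod_cast hε
  rw [add_comm, add_assoc, ← add_smul]
  convert (add_zero _).symm using 2
  convert zero_smul ℂ _ using 2
  field_simp
  ring

end Xi

/-! ### The inner product with values in the smooth torus -/

section InnerProduct

variable {q : ℕ}

/-- The standard sesquilinear form on `ℂ^q` (conjugate linear in the first variable), as a
continuous real bilinear map. -/
def stdPairing (q : ℕ) : (Fin q → ℂ) →L[ℝ] (Fin q → ℂ) →L[ℝ] ℂ :=
  LinearMap.toContinuousBilinearMap <| LinearMap.mk₂ ℝ (fun u v : Fin q → ℂ => star u ⬝ᵥ v)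
    (fun u u' v => by rw [star_add, add_dotProduct])
    (fun c u v => by rw [star_smul, smul_dotProduct]; rfl)
    (fun u v v' => dotProduct_add _ _ _)
    (fun c u v => dotProduct_smul _ _ _)

lemma stdPairing_apply (u v : Fin q → ℂ) : stdPairing q u v = star u ⬝ᵥ v := rfl

lemma norm_star_dotProduct_le (u v : Fin q → ℂ) : ‖star u ⬝ᵥ v‖ ≤ q * (‖u‖ * ‖v‖) := by
  calc ‖star u ⬝ᵥ v‖ ≤ ∑ i : Fin q, ‖star u i * v i‖ := norm_sum_le _ _
    _ ≤ ∑ _i : Fin q, ‖u‖ * ‖v‖ := by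
        refine Finset.sum_le_sum fun i _ => ?_
        rw [norm_mul, Pi.star_apply, norm_star]
        gcongr
        · exact norm_le_pi_norm u i
        · exact norm_le_pi_norm v i
    _ = q * (‖u‖ * ‖v‖) := by simp

lemma star_mulVec_dotProduct_mulVec (V : Matrix.unitaryGroup (Fin q) ℂ) (u v : Fin q → ℂ) :
    star ((V : Matrix (Fin q) (Fin q) ℂ).mulVec u) ⬝ᵥ (V : Matrix (Fin q) (Fin q) ℂ).mulVec v =
      star u ⬝ᵥ v := by
  have h : star (V : Matrix (Fin q) (Fin q) ℂ) * (V : Matrix (Fin q) (Fin q) ℂ) = 1 :=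
    Matrix.mem_unitaryGroup_iff'.mp V.2
  rw [Matrix.star_mulVec, ← Matrix.dotProduct_mulVec, Matrix.mulVec_mulVec,
    ← Matrix.star_eq_conjTranspose, h, Matrix.one_mulVec]

lemma star_exp_mul_exp (t : ℝ) (m : ℤ) :
    star (Complex.exp (2 * Real.pi * Complex.I * m * t)) *
      Complex.exp (2 * Real.pi * Complex.I * m * t) = 1 := by
  rw [Complex.star_def, ← Complex.exp_conj, ← Complex.exp_add, Complex.exp_eq_one_iff]
  exact ⟨0, by simp [map_ofNat (starRingEnd ℂ) 2]⟩

end InnerProduct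

namespace Xi

open MulOpposite (op)
open NCTorus.SmoothTorus (monomial)

variable {θ : ℝ} {p : ℤ} {q : ℕ} {W : WeylPair q}

lemma integrable_dotProduct (η ζ : Xi θ p W) :
    MeasureTheory.Integrable (fun t => star (η t) ⬝ᵥ ζ t) :=
  (SchwartzMap.pairing (stdPairing q) (η : 𝓢(ℝ, Fin q → ℂ)) (ζ : 𝓢(ℝ, Fin q → ℂ))).integrable

/-- The `L²` inner product of `ℂ^q`-valued Schwartz functions, conjugate linear in the first
variable. -/
def l2Inner (η ζ : Xi θ p W) : ℂ := ∫ t, star (η t) ⬝ᵥ ζ t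

/-- The monomials `U₁ⁿ U₂ᵐ` act isometrically. -/
lemma l2Inner_op_smul_op_smul (x : ℤ × ℤ) (η ζ : Xi θ p W) :
    l2Inner (op (monomial x : SmoothTorus θ) • η) (op (monomial x : SmoothTorus θ) • ζ) =
      l2Inner η ζ := by
  have h : ∀ t, star ((op (monomial x : SmoothTorus θ) • η) t) ⬝ᵥ
      (op (monomial x : SmoothTorus θ) • ζ) t =
        star (η (t - x.1 * eps θ p q)) ⬝ᵥ ζ (t - x.1 * eps θ p q) := fun t => by
    simp only [op_smul_monomial, weylShift]
    rw [star_smul, smul_dotProduct, dotProduct_smul, smul_smul, star_exp_mul_exp, one_smul,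
      star_mulVec_dotProduct_mulVec]
  simp only [l2Inner, h]
  exact MeasureTheory.integral_sub_right_eq_self (μ := MeasureTheory.volume)
    (fun t => star (η t) ⬝ᵥ ζ t) (x.1 * eps θ p q)

lemma l2Inner_add_left (η η' ζ : Xi θ p W) :
    l2Inner (η + η') ζ = l2Inner η ζ + l2Inner η' ζ := by
  unfold l2Inner
  rw [← MeasureTheory.integral_add (integrable_dotProduct η ζ) (integrable_dotProduct η' ζ)]
  simp only [add_apply, star_add, add_dotProduct]

lemma l2Inner_add_right (η ζ ζ' : Xi θ p W) :
    l2Inner η (ζ + ζ') = l2Inner η ζ + l2Inner η ζ' := by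
  unfold l2Inner
  rw [← MeasureTheory.integral_add (integrable_dotProduct η ζ) (integrable_dotProduct η ζ')]
  simp only [add_apply, dotProduct_add]

lemma l2Inner_smul_left (c : ℂ) (η ζ : Xi θ p W) :
    l2Inner (c • η) ζ = star c * l2Inner η ζ := by
  unfold l2Inner
  rw [← MeasureTheory.integral_const_mul]
  simp only [smul_apply, star_smul, smul_dotProduct, smul_eq_mul]

lemma norm_l2Inner_le (η ζ : Xi θ p W) {B : ℝ} (hη : ∀ t, ‖η t‖ ≤ B) :
    ‖l2Inner η ζ‖ ≤ q * (B * ∫ t, ‖ζ t‖) := by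
  unfold l2Inner
  rw [← MeasureTheory.integral_const_mul, ← MeasureTheory.integral_const_mul]
  refine MeasureTheory.norm_integral_le_of_norm_le
    ((ζ.integrable.norm.const_mul B).const_mul (q : ℝ)) (Filter.Eventually.of_forall fun t => ?_)
  refine (norm_star_dotProduct_le _ _).trans ?_
  gcongr
  exact hη t

/-- `∇₁` is skew-adjoint, being multiplication by an imaginary function. -/
lemma l2Inner_nabla₁ (η ζ : Xi θ p W) :
    l2Inner (nabla₁ θ p W η) ζ = -l2Inner η (nabla₁ θ p W ζ) := by
  unfold l2Inner
  rw [← MeasureTheory.integral_neg]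
  congr 1
  funext t
  rw [nabla₁_apply, nabla₁_apply, star_smul, smul_dotProduct, dotProduct_smul, ← neg_smul]
  congr 1
  simp
  ring

/-- `∇₂` is skew-adjoint, by integration by parts. -/
lemma l2Inner_nabla₂ (η ζ : Xi θ p W) :
    l2Inner (nabla₂ θ p W η) ζ = -l2Inner η (nabla₂ θ p W ζ) := by
  have h := SchwartzMap.integral_bilinear_deriv_right_eq_neg_left (η : 𝓢(ℝ, Fin q → ℂ))
    (ζ : 𝓢(ℝ, Fin q → ℂ)) (stdPairing q)
  exact (neg_eq_iff_eq_neg.mpr h).symm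

/-- The coefficient of `U₁ⁿ U₂ᵐ`, for `x = (n, m)`, in the `A_θ^∞`-valued inner product of `η`
and `ζ`: the `L²` inner product of `η · U₁ⁿ U₂ᵐ` and `ζ`. -/
def innerCoeff (η ζ : Xi θ p W) (x : ℤ × ℤ) : ℂ :=
  l2Inner (op (monomial x : SmoothTorus θ) • η) ζ

lemma innerCoeff_nabla₁ [NeZero q] (hε : eps θ p q ≠ 0) (η ζ : Xi θ p W) (x : ℤ × ℤ) :
    2 * Real.pi * Complex.I * x.1 * innerCoeff η ζ x =
      innerCoeff η (nabla₁ θ p W ζ) x + innerCoeff (nabla₁ θ p W η) ζ x := by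
  have h := l2Inner_nabla₁ (op (monomial x : SmoothTorus θ) • η) ζ
  rw [nabla₁_op_smul hε, l2Inner_add_left, SmoothTorus.delta_monomial, MulOpposite.op_smul,
    smul_assoc, l2Inner_smul_left] at h
  simp only [innerCoeff]
  simp at h
  linear_combination -h

lemma innerCoeff_nabla₂ [NeZero q] (η ζ : Xi θ p W) (x : ℤ × ℤ) :
    2 * Real.pi * Complex.I * x.2 * innerCoeff η ζ x =
      innerCoeff η (nabla₂ θ p W ζ) x + innerCoeff (nabla₂ θ p W η) ζ x := by
  have h := l2Inner_nabla₂ (op (monomial x : SmoothTorus θ) • η) ζ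
  rw [nabla₂_op_smul, l2Inner_add_left, SmoothTorus.delta_monomial, MulOpposite.op_smul,
    smul_assoc, l2Inner_smul_left] at h
  simp only [innerCoeff]
  simp at h
  linear_combination -h

lemma exists_innerCoeff_bound (η ζ : Xi θ p W) : ∃ C, ∀ x, ‖innerCoeff η ζ x‖ ≤ C := by
  obtain ⟨B, hB, h⟩ := η.exists_norm_le
  refine ⟨q * (q * B * ∫ t, ‖ζ t‖), fun x => norm_l2Inner_le _ _ fun t => ?_⟩
  rw [op_smul_monomial]
  refine (norm_weylShift_le θ p W x η t).trans ?_
  gcongr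
  exact h _

lemma norm_le_of_two_pi_mul_eq {n : ℤ} {c u v : ℂ}
    (h : 2 * Real.pi * Complex.I * n * c = u + v) : |(n : ℝ)| * ‖c‖ ≤ ‖u‖ + ‖v‖ := by
  have h1 : 2 * Real.pi * (|(n : ℝ)| * ‖c‖) = ‖u + v‖ := by
    rw [← h]
    simp [abs_of_pos Real.pi_pos, mul_assoc]
  have h2 : 1 ≤ 2 * Real.pi := by linarith [Real.pi_gt_three]
  calc |(n : ℝ)| * ‖c‖ ≤ 2 * Real.pi * (|(n : ℝ)| * ‖c‖) := le_mul_of_one_le_left (by positivity) h2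
    _ ≤ ‖u‖ + ‖v‖ := h1 ▸ norm_add_le u v

/-- The coefficients of the `A_θ^∞`-valued inner product decay rapidly: multiplication by `n` or
`m` is traded for an application of `∇₁` or `∇₂`. -/
lemma rapidDecay_innerCoeff [NeZero q] (hε : eps θ p q ≠ 0) (η ζ : Xi θ p W) :
    RapidDecay (innerCoeff η ζ) := by
  intro k
  induction k generalizing η ζ with
  | zero => simpa using exists_innerCoeff_bound η ζ
  | succ k ih =>
    obtain ⟨C, hC⟩ := ih η ζ
    obtain ⟨C₁, h₁⟩ := ih η (nabla₁ θ p W ζ)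
    obtain ⟨C₂, h₂⟩ := ih (nabla₁ θ p W η) ζ
    obtain ⟨C₃, h₃⟩ := ih η (nabla₂ θ p W ζ)
    obtain ⟨C₄, h₄⟩ := ih (nabla₂ θ p W η) ζ
    refine ⟨C + (C₁ + C₂) + (C₃ + C₄), fun x => ?_⟩
    have hw := weight_pos x
    have e₁ := norm_le_of_two_pi_mul_eq (innerCoeff_nabla₁ hε η ζ x)
    have e₂ := norm_le_of_two_pi_mul_eq (innerCoeff_nabla₂ η ζ x)
    calc weight x ^ (k + 1) * ‖innerCoeff η ζ x‖
        = weight x ^ k * ‖innerCoeff η ζ x‖ + weight x ^ k * (|(x.1 : ℝ)| * ‖innerCoeff η ζ x‖) +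
            weight x ^ k * (|(x.2 : ℝ)| * ‖innerCoeff η ζ x‖) := by
          rw [pow_succ]
          conv_lhs => enter [1, 2]; rw [weight]
          ring
      _ ≤ weight x ^ k * ‖innerCoeff η ζ x‖ +
            weight x ^ k * (‖innerCoeff η (nabla₁ θ p W ζ) x‖ +
              ‖innerCoeff (nabla₁ θ p W η) ζ x‖) +
            weight x ^ k * (‖innerCoeff η (nabla₂ θ p W ζ) x‖ +
              ‖innerCoeff (nabla₂ θ p W η) ζ x‖) := by gcongr
      _ ≤ _ := by
          rw [mul_add, mul_add]
          exact add_le_add (add_le_add (hC x) (add_le_add (h₁ x) (h₂ x)))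
            (add_le_add (h₃ x) (h₄ x))

/-- The series `ζ · b` may be paired with `η` termwise. -/
lemma l2Inner_op_smul (η ζ : Xi θ p W) (b : SmoothTorus θ) :
    l2Inner η (op b • ζ) =
      ∑' y, b.coeff y * l2Inner η (op (monomial y : SmoothTorus θ) • ζ) := by
  obtain ⟨B, hB, h⟩ := ζ.exists_norm_le
  let F : ℤ × ℤ → ℝ → ℂ := fun y t => b.coeff y * (star (η t) ⬝ᵥ weylShift θ p W y ζ t)
  have hF : ∀ y t, F y t = b.coeff y *
      (star (η t) ⬝ᵥ (op (monomial y : SmoothTorus θ) • ζ) t) := fun y t => by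
    rw [op_smul_monomial]
  have hint : ∀ y, MeasureTheory.Integrable (F y) := fun y => by
    rw [funext (hF y)]
    exact (integrable_dotProduct η _).const_mul _
  have hsum : Summable fun y => ∫ t, ‖F y t‖ := by
    refine Summable.of_nonneg_of_le (fun y => MeasureTheory.integral_nonneg fun t => norm_nonneg _)
      (fun y => ?_) (b.rapidDecay.summable_norm.mul_right (q * ((∫ t, ‖η t‖) * (q * B))))
    rw [← MeasureTheory.integral_mul_const, ← MeasureTheory.integral_const_mul,
      ← MeasureTheory.integral_const_mul]
    refine MeasureTheory.integral_mono (hint y).norm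
      (((η.integrable.norm.mul_const _).const_mul _).const_mul _) fun t => ?_
    dsimp only [F]
    rw [norm_mul]
    gcongr
    refine (norm_star_dotProduct_le _ _).trans ?_
    gcongr
    refine (norm_weylShift_le θ p W y ζ t).trans ?_
    gcongr
    exact h _
  have key := MeasureTheory.integral_tsum_of_summable_integral_norm hint hsum
  have e1 : l2Inner η (op b • ζ) = ∫ t, ∑' y, F y t := by
    unfold l2Inner
    congr 1
    funext t
    have hs := summable b ζ t
    have := (stdPairing q (η t)).map_tsum hs
    rw [act_apply, ← stdPairing_apply, this]
    refine tsum_congr fun y => ?_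
    rw [stdPairing_apply, dotProduct_smul, smul_eq_mul]
  rw [e1, ← key]
  refine tsum_congr fun y => ?_
  rw [l2Inner, ← MeasureTheory.integral_const_mul]
  simp only [hF]

lemma star_phase_mul (x y : ℤ × ℤ) : star (phase θ x y) * phase θ x y = 1 := by
  rw [Complex.star_def, mul_comm, Complex.mul_conj, Complex.normSq_eq_norm_sq, norm_phase]
  simp

variable [NeZero q]

lemma l2Inner_monomial_monomial (η ζ : Xi θ p W) (x y : ℤ × ℤ) :
    l2Inner (op (monomial (x + y) : SmoothTorus θ) • η) (op (monomial y : SmoothTorus θ) • ζ) =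
      innerCoeff η ζ x * phase θ x y := by
  have h1 : op (monomial y : SmoothTorus θ) • op (monomial x : SmoothTorus θ) • η =
      phase θ x y • op (monomial (x + y) : SmoothTorus θ) • η := by
    rw [smul_smul, ← MulOpposite.op_mul, SmoothTorus.monomial_mul_monomial, MulOpposite.op_smul,
      smul_assoc]
  have h3 : l2Inner (op (monomial y : SmoothTorus θ) • op (monomial x : SmoothTorus θ) • η)
      (op (monomial y : SmoothTorus θ) • ζ) = innerCoeff η ζ x :=
    l2Inner_op_smul_op_smul y _ ζ
  rw [h1, l2Inner_smul_left] at h3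
  rw [← h3]
  linear_combination (-l2Inner (op (monomial (x + y) : SmoothTorus θ) • η)
    (op (monomial y : SmoothTorus θ) • ζ)) * star_phase_mul (θ := θ) x y

/-- `⟨η, ζ · b⟩ = ⟨η, ζ⟩ b`, coefficientwise. -/
lemma innerCoeff_op_smul (η ζ : Xi θ p W) (b : SmoothTorus θ) :
    innerCoeff η (op b • ζ) = twistedConv θ (innerCoeff η ζ) b.coeff := by
  funext z
  rw [innerCoeff, l2Inner_op_smul, twistedConv, ← (Equiv.subLeft z).tsum_eq]
  refine tsum_congr fun x => ?_
  rw [Equiv.subLeft_apply]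
  have h := l2Inner_monomial_monomial η ζ x (z - x)
  rw [add_sub_cancel] at h
  rw [h]
  ring

/-- The `A_θ^∞`-valued inner product on the Schwartz module, linear in the second variable, as an
`A_θ^∞`-linear functional of that variable. -/
def torusInner (hε : eps θ p q ≠ 0) (η : Xi θ p W) :
    Xi θ p W →ₗ[(SmoothTorus θ)ᵐᵒᵖ] SmoothTorus θ where
  toFun ζ := ⟨innerCoeff η ζ, rapidDecay_innerCoeff hε η ζ⟩
  map_add' ζ ζ' := by
    ext x
    exact l2Inner_add_right _ ζ ζ'
  map_smul' a ζ := by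
    obtain ⟨a, rfl⟩ := MulOpposite.op_surjective a
    ext x
    exact congrFun (innerCoeff_op_smul η ζ a) x

lemma torusInner_coeff (hε : eps θ p q ≠ 0) (η ζ : Xi θ p W) (x : ℤ × ℤ) :
    (torusInner hε η ζ).coeff x = innerCoeff η ζ x := rfl

lemma trace_torusInner (hε : eps θ p q ≠ 0) (η ζ : Xi θ p W) :
    (torusInner hε η ζ).trace = l2Inner η ζ := by
  have : op (monomial 0 : SmoothTorus θ) • η = η := one_smul _ η
  rw [SmoothTorus.trace, torusInner_coeff, innerCoeff, this]

end Xi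

/-! ### Frames and finite projective modules -/

section Frame

open MulOpposite (op)

variable {θ : ℝ} {M : Type} [AddCommGroup M] [Module (SmoothTorus θ)ᵐᵒᵖ M] {n : ℕ}

/-- A finite frame of a right module `M` over `A = A_θ^∞`: vectors `u i` of `M` and `A`-valued
functionals `φ i` on `M` with `ξ = ∑ i, u i · φ i ξ`. -/
structure Frame (θ : ℝ) (M : Type) [AddCommGroup M] [Module (SmoothTorus θ)ᵐᵒᵖ M] (n : ℕ) where
  vec : Fin n → M
  functional : Fin n → M →ₗ[(SmoothTorus θ)ᵐᵒᵖ] SmoothTorus θ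
  reconstruct : ∀ ξ : M, ∑ i, op (functional i ξ) • vec i = ξ

namespace Frame

variable (F : Frame θ M n)

lemma functional_op_smul (i : Fin n) (a : SmoothTorus θ) (ξ : M) :
    F.functional i (op a • ξ) = F.functional i ξ * a := by
  rw [map_smul, op_smul_eq_mul]

/-- The matrix `(φ i (u j))` of a frame, which is idempotent. -/
def projection : Matrix (Fin n) (Fin n) (SmoothTorus θ) :=
  Matrix.of fun i j => F.functional i (F.vec j)

lemma projection_mulVec (v : Fin n → SmoothTorus θ) :
    F.projection.mulVec v = fun i => F.functional i (∑ j, op (v j) • F.vec j) := by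
  funext i
  simp only [map_sum, functional_op_smul]
  rfl

lemma projection_mulVec_functional (ξ : M) :
    (F.projection.mulVec fun i => F.functional i ξ) = fun i => F.functional i ξ := by
  rw [projection_mulVec, F.reconstruct]

lemma projection_mul_self : F.projection * F.projection = F.projection := by
  ext1 i j
  exact congrFun (F.projection_mulVec_functional (F.vec j)) i

/-- A module with a frame is isomorphic to `e A^n`, `e` the matrix of the frame. -/
def equivIdemModule : M ≃ₗ[(SmoothTorus θ)ᵐᵒᵖ] idemModule F.projection where
  toFun ξ := ⟨fun i => F.functional i ξ, F.projection_mulVec_functional ξ⟩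
  invFun v := ∑ j, op (v.1 j) • F.vec j
  map_add' ξ η := by
    ext1
    funext i
    exact map_add _ _ _
  map_smul' a ξ := by
    ext1
    funext i
    exact map_smul _ _ _
  left_inv ξ := F.reconstruct ξ
  right_inv v := by
    ext1
    exact (F.projection_mulVec v.1).symm.trans v.2

lemma hasDimension [Module ℂ M] {d : ℝ} (h : matrixTrace F.projection = d) :
    HasDimension θ M d :=
  ⟨n, F.projection, F.projection_mul_self, ⟨F.equivIdemModule⟩, h⟩

/-- A scalar endomorphism `c` corresponds to `c e`, so its trace is `c (τ ⊗ Tr) (e)`. -/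
lemma hasEndTrace [Module ℂ M] [IsScalarTower ℂ (SmoothTorus θ)ᵐᵒᵖ M] {c : ℂ}
    {T : Module.End (SmoothTorus θ)ᵐᵒᵖ M} (hT : ∀ ξ, T ξ = c • ξ) :
    HasEndTrace T (c * matrixTrace F.projection) := by
  refine ⟨n, F.projection, c • F.projection, F.equivIdemModule, F.projection_mul_self, ?_, ?_, ?_⟩
  · rw [mul_smul_comm, smul_mul_assoc, F.projection_mul_self, F.projection_mul_self]
  · intro ξ
    have h1 : c • ξ = (c • (1 : (SmoothTorus θ)ᵐᵒᵖ)) • ξ := by rw [smul_assoc, one_smul]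
    have h2 : (F.equivIdemModule ξ : Fin n → SmoothTorus θ) = fun i => F.functional i ξ := rfl
    rw [hT, h1, map_smul, Matrix.smul_mulVec, h2, F.projection_mulVec_functional]
    change (c • (1 : (SmoothTorus θ)ᵐᵒᵖ)) • (F.equivIdemModule ξ : Fin n → SmoothTorus θ) = _
    rw [h2, smul_assoc, one_smul]
  · simp only [matrixTrace, Finset.mul_sum]
    rfl

lemma module_finite (F : Frame θ M n) : Module.Finite (SmoothTorus θ)ᵐᵒᵖ M :=
  Module.Finite.of_surjective (Fintype.linearCombination (SmoothTorus θ)ᵐᵒᵖ F.vec) fun ξ =>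
    ⟨fun i => op (F.functional i ξ), F.reconstruct ξ⟩

lemma module_projective (F : Frame θ M n) : Module.Projective (SmoothTorus θ)ᵐᵒᵖ M := by
  let s : M →ₗ[(SmoothTorus θ)ᵐᵒᵖ] Fin n → (SmoothTorus θ)ᵐᵒᵖ :=
    { toFun := fun ξ i => op (F.functional i ξ)
      map_add' := fun ξ η => by funext i; simp
      map_smul' := fun a ξ => by
        obtain ⟨a, rfl⟩ := MulOpposite.op_surjective a
        funext i
        simp [F.functional_op_smul] }
  exact Module.Projective.of_split s (Fintype.linearCombination (SmoothTorus θ)ᵐᵒᵖ F.vec)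
    (LinearMap.ext F.reconstruct)

/-- A frame indexed by an arbitrary finite type, enumerated. -/
def ofFintype {ι : Type*} [Fintype ι] (u : ι → M)
    (φ : ι → M →ₗ[(SmoothTorus θ)ᵐᵒᵖ] SmoothTorus θ) (h : ∀ ξ : M, ∑ i, op (φ i ξ) • u i = ξ) :
    Frame θ M (Fintype.card ι) where
  vec k := u ((Fintype.equivFin ι).symm k)
  functional k := φ ((Fintype.equivFin ι).symm k)
  reconstruct ξ :=
    ((Fintype.equivFin ι).symm.sum_comp fun i => op (φ i ξ) • u i).trans (h ξ)

lemma matrixTrace_projection_ofFintype {ι : Type*} [Fintype ι] (u : ι → M)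
    (φ : ι → M →ₗ[(SmoothTorus θ)ᵐᵒᵖ] SmoothTorus θ) (h : ∀ ξ : M, ∑ i, op (φ i ξ) • u i = ξ) :
    matrixTrace (ofFintype u φ h).projection = ∑ i, (φ i (u i)).trace :=
  (Fintype.equivFin ι).symm.sum_comp fun i => (φ i (u i)).trace

end Frame

end Frame

/-! ### A partition of unity -/

section PartitionOfUnity

/-- A smooth bump supported in `[-1, 1]` whose integer translates form a partition of unity. -/
def unitBump (u : ℝ) : ℝ := Real.smoothTransition (u + 1) - Real.smoothTransition u

lemma contDiff_unitBump : ContDiff ℝ ∞ unitBump := by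
  unfold unitBump
  exact (Real.smoothTransition.contDiff.comp (contDiff_id.add contDiff_const)).sub
    Real.smoothTransition.contDiff

lemma unitBump_of_one_le_abs {u : ℝ} (h : 1 ≤ |u|) : unitBump u = 0 := by
  unfold unitBump
  rcases le_abs'.mp h with h | h
  · rw [Real.smoothTransition.zero_of_nonpos (by linarith),
      Real.smoothTransition.zero_of_nonpos (by linarith), sub_zero]
  · rw [Real.smoothTransition.one_of_one_le (by linarith),
      Real.smoothTransition.one_of_one_le (by linarith), sub_self]

lemma hasSum_unitBump (u : ℝ) : HasSum (fun k : ℤ => unitBump (u - k)) 1 := by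
  -- only the translates by `⌊u⌋` and `⌊u⌋ + 1` are nonzero at `u`
  have h0 := Int.floor_le u
  have h1 := Int.lt_floor_add_one u
  have e : (1 : ℝ) = ∑ k ∈ {⌊u⌋, ⌊u⌋ + 1}, unitBump (u - k) := by
    rw [Finset.sum_pair (by simp)]
    unfold unitBump
    push_cast
    rw [Real.smoothTransition.one_of_one_le (x := u - ⌊u⌋ + 1) (by linarith),
      Real.smoothTransition.zero_of_nonpos (x := u - (⌊u⌋ + 1)) (by linarith)]
    ring_nf
  rw [e]
  refine hasSum_sum_of_ne_finset_zero fun k hk => unitBump_of_one_le_abs ?_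
  simp only [Finset.mem_insert, Finset.mem_singleton, not_or] at hk
  rcases lt_or_gt_of_ne hk.1 with h | h
  · have : (k : ℝ) + 1 ≤ ⌊u⌋ := by exact_mod_cast h
    exact le_abs.mpr (Or.inl (by linarith))
  · have : (⌊u⌋ : ℝ) + 1 + 1 ≤ k := by
      have h2 : ⌊u⌋ + 1 + 1 ≤ k := by have := hk.2; omega
      exact_mod_cast h2
    exact le_abs.mpr (Or.inr (by linarith))

lemma integral_unitBump : ∫ u, unitBump u = 1 := by
  have hc : Continuous Real.smoothTransition := Real.smoothTransition.continuous
  have hi : ∀ a b : ℝ, IntervalIntegrable Real.smoothTransition MeasureTheory.volume a b :=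
    fun a b => hc.intervalIntegrable a b
  have hs : Function.support unitBump ⊆ Set.Ioc (-1) 1 := fun u hu => by
    have h : |u| < 1 := lt_of_not_ge fun h => hu (unitBump_of_one_le_abs h)
    exact ⟨(abs_lt.mp h).1, (abs_lt.mp h).2.le⟩
  rw [← intervalIntegral.integral_eq_integral_of_support_subset hs]
  unfold unitBump
  have hi' : IntervalIntegrable (fun u => Real.smoothTransition (u + 1)) MeasureTheory.volume
      (-1) 1 := (hc.comp (continuous_id.add continuous_const)).intervalIntegrable _ _
  rw [intervalIntegral.integral_sub hi' (hi _ _),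
    intervalIntegral.integral_comp_add_right (fun u => Real.smoothTransition u)]
  have e1 := intervalIntegral.integral_add_adjacent_intervals (hi 0 1) (hi 1 2)
  have e2 := intervalIntegral.integral_add_adjacent_intervals (hi (-1) 0) (hi 0 1)
  have e3 : ∫ u in (1 : ℝ)..2, Real.smoothTransition u = 1 := by
    rw [intervalIntegral.integral_congr (g := fun _ => (1 : ℝ)) fun u hu => ?_]
    · norm_num
    · rw [Set.uIcc_of_le (by norm_num)] at hu
      exact Real.smoothTransition.one_of_one_le hu.1
  have e4 : ∫ u in (-1 : ℝ)..0, Real.smoothTransition u = 0 := by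
    rw [intervalIntegral.integral_congr (g := fun _ => (0 : ℝ)) fun u hu => ?_]
    · simp
    · rw [Set.uIcc_of_le (by norm_num)] at hu
      exact Real.smoothTransition.zero_of_nonpos hu.2
  norm_num
  linarith

/-- For a nonzero period `ε` cut into `N` equal steps, the bumps on the steps form a partition of
unity under translation by multiples of `ε`. -/
lemma hasSum_unitBump_step {N : ℕ} [NeZero N] {ε : ℝ} (hε : ε ≠ 0) (s : ℝ) :
    HasSum (fun x : ℤ × Fin N => unitBump ((s - x.1 * ε) / (ε / N) - (x.2 : ℕ))) 1 := by
  have hN : (N : ℝ) ≠ 0 := Nat.cast_ne_zero.mpr (NeZero.ne N)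
  have h := (Int.divModEquiv N).symm.hasSum_iff.mpr (hasSum_unitBump (s / (ε / N)))
  refine h.congr_fun fun x => ?_
  simp only [Function.comp_apply, Int.divModEquiv, Equiv.coe_fn_symm_mk]
  congr 1
  push_cast
  field_simp
  ring

end PartitionOfUnity

/-! ### Reconstruction by Poisson summation -/

section Reconstruction

/-- The vectors `V e_j`, for a unitary `V`, form an orthonormal basis. -/
lemma sum_star_mulVec_dotProduct_smul {q : ℕ} (V : Matrix.unitaryGroup (Fin q) ℂ)
    (v : Fin q → ℂ) :
    ∑ j, (star ((V : Matrix (Fin q) (Fin q) ℂ).mulVec (Pi.single j 1)) ⬝ᵥ v) •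
      (V : Matrix (Fin q) (Fin q) ℂ).mulVec (Pi.single j 1) = v := by
  have h : (V : Matrix (Fin q) (Fin q) ℂ) * star (V : Matrix (Fin q) (Fin q) ℂ) = 1 :=
    Matrix.mem_unitaryGroup_iff.mp V.2
  set w := (star (V : Matrix (Fin q) (Fin q) ℂ)).mulVec v with hw
  have h1 : ∀ j, star ((V : Matrix (Fin q) (Fin q) ℂ).mulVec (Pi.single j 1)) ⬝ᵥ v = w j := by
    intro j
    rw [Matrix.star_mulVec, ← Matrix.dotProduct_mulVec, ← Pi.single_star, star_one,
      single_dotProduct, one_mul]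
    rfl
  simp only [h1, ← Matrix.mulVec_smul]
  rw [← Matrix.mulVec_sum]
  have h2 : ∑ j, w j • Pi.single (M := fun _ : Fin q => ℂ) j (1 : ℂ) = w := by
    funext l
    simp [Finset.sum_apply, Pi.single_apply]
  rw [h2, hw, Matrix.mulVec_mulVec, h, Matrix.one_mulVec]

namespace Xi

open MulOpposite (op)

variable {θ : ℝ} {p : ℤ} {q : ℕ} {W : WeylPair q}

/-- The element `f ⊗ e_j` of `𝓢(ℝ) ⊗ ℂ^q`. -/
def tensorBasis (θ : ℝ) (p : ℤ) (W : WeylPair q) (f : 𝓢(ℝ, ℂ)) (j : Fin q) : Xi θ p W :=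
  SchwartzMap.postcompCLM (ContinuousLinearMap.toSpanSingleton ℂ (Pi.single j 1 : Fin q → ℂ)) f

lemma tensorBasis_apply (f : 𝓢(ℝ, ℂ)) (j : Fin q) (s : ℝ) :
    tensorBasis θ p W f j s = f s • Pi.single j 1 := rfl

/-- The Schwartz function `t ↦ conj (g (t - n ε)) ζ_l (t)`. -/
def conjMulCoord (g : 𝓢(ℝ, ℂ)) (ζ : Xi θ p W) (n : ℤ) (l : Fin q) : 𝓢(ℝ, ℂ) :=
  SchwartzMap.pairing
    ((ContinuousLinearMap.mul ℝ ℂ).comp (Complex.conjCLE : ℂ →L[ℝ] ℂ))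
    (SchwartzMap.compSubConstCLM ℝ (n * eps θ p q) g)
    (SchwartzMap.postcompCLM (ContinuousLinearMap.proj l : (Fin q → ℂ) →L[ℝ] ℂ)
      (ζ : 𝓢(ℝ, Fin q → ℂ)))

lemma conjMulCoord_apply (g : 𝓢(ℝ, ℂ)) (ζ : Xi θ p W) (n : ℤ) (l : Fin q) (t : ℝ) :
    conjMulCoord g ζ n l t = star (g (t - n * eps θ p q)) * ζ t l := rfl

lemma weylShift_tensorBasis (f : 𝓢(ℝ, ℂ)) (j : Fin q) (x : ℤ × ℤ) (s : ℝ) :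
    weylShift θ p W x (tensorBasis θ p W f j) s =
      (Complex.exp (2 * Real.pi * Complex.I * x.2 * s) * f (s - x.1 * eps θ p q)) •
        (W.word p x : Matrix (Fin q) (Fin q) ℂ).mulVec (Pi.single j 1) := by
  rw [weylShift, tensorBasis_apply, Matrix.mulVec_smul, smul_smul]

open scoped FourierTransform in
lemma innerCoeff_tensorBasis (g : 𝓢(ℝ, ℂ)) (j : Fin q) (ζ : Xi θ p W) (x : ℤ × ℤ) :
    innerCoeff (tensorBasis θ p W g j) ζ x =
      star ((W.word p x : Matrix (Fin q) (Fin q) ℂ).mulVec (Pi.single j 1)) ⬝ᵥ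
        fun l => 𝓕 (conjMulCoord g ζ x.1 l) (x.2 : ℝ) := by
  have hF : ∀ l, 𝓕 (conjMulCoord g ζ x.1 l) (x.2 : ℝ) =
      ∫ t : ℝ, star (Complex.exp (2 * Real.pi * Complex.I * x.2 * t)) *
        conjMulCoord g ζ x.1 l t := fun l => by
    rw [SchwartzMap.fourier_coe, Real.fourier_real_eq_integral_exp_smul]
    congr 1
    funext t
    rw [smul_eq_mul, Complex.star_def, ← Complex.exp_conj]
    congr 2
    simp [map_ofNat (starRingEnd ℂ) 2]
    ring
  have hint : ∀ l, MeasureTheory.Integrable (fun t : ℝ =>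
      star (Complex.exp (2 * Real.pi * Complex.I * x.2 * t)) * conjMulCoord g ζ x.1 l t) := by
    intro l
    refine (conjMulCoord g ζ x.1 l).integrable.bdd_mul (c := 1)
      (Continuous.aestronglyMeasurable (by fun_prop)) (Filter.Eventually.of_forall fun t => ?_)
    have e : Complex.exp (2 * Real.pi * Complex.I * x.2 * t) =
        Complex.exp (((2 * Real.pi * x.2 * t : ℝ) : ℂ) * Complex.I) := by
      congr 1; push_cast; ring
    rw [norm_star, e, Complex.norm_exp_ofReal_mul_I]
  simp only [hF, dotProduct]
  simp only [← MeasureTheory.integral_const_mul]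
  rw [← MeasureTheory.integral_finsetSum _ fun l _ => (hint l).const_mul _]
  unfold innerCoeff l2Inner
  congr 1
  funext t
  rw [op_smul_monomial, weylShift_tensorBasis, star_smul, smul_dotProduct, dotProduct,
    Finset.smul_sum]
  refine Finset.sum_congr rfl fun l _ => ?_
  rw [conjMulCoord_apply, smul_eq_mul, star_mul']
  ring

open scoped FourierTransform in
lemma sum_innerCoeff_smul (f g : 𝓢(ℝ, ℂ)) (ζ : Xi θ p W) (x : ℤ × ℤ) (s : ℝ) :
    ∑ j, innerCoeff (tensorBasis θ p W g j) ζ x • weylShift θ p W x (tensorBasis θ p W f j) s =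
      fun l => f (s - x.1 * eps θ p q) * (𝓕 (conjMulCoord g ζ x.1 l) (x.2 : ℝ) *
        Complex.exp (2 * Real.pi * Complex.I * x.2 * s)) := by
  simp only [innerCoeff_tensorBasis, weylShift_tensorBasis]
  simp only [smul_comm _ (Complex.exp (2 * Real.pi * Complex.I * x.2 * s) *
    f (s - x.1 * eps θ p q))]
  rw [← Finset.smul_sum, sum_star_mulVec_dotProduct_smul]
  funext l
  simp only [Pi.smul_apply, smul_eq_mul]
  ring

open scoped FourierTransform in
/-- Poisson summation over the powers of `U₂`. -/
lemma tsum_fourier_conjMulCoord (g : 𝓢(ℝ, ℂ)) (ζ : Xi θ p W) (n : ℤ) (l : Fin q) (s : ℝ) :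
    ∑' m : ℤ, 𝓕 (conjMulCoord g ζ n l) (m : ℝ) *
        Complex.exp (2 * Real.pi * Complex.I * m * s) =
      ∑' k : ℤ, star (g (s - n * eps θ p q + k)) * ζ (s + k) l := by
  have h := SchwartzMap.tsum_eq_tsum_fourier (conjMulCoord g ζ n l) s
  simp only [fourier_coe_apply, Complex.ofReal_one, div_one] at h
  rw [← h]
  refine tsum_congr fun k => ?_
  rw [conjMulCoord_apply]
  congr 4
  ring

variable [NeZero q]

/-- If on the support of `f` the function `g` is `1` and its translates by nonzero integers
vanish, the operator `ζ ↦ ∑ j, (f ⊗ e_j) · ⟨g ⊗ e_j, ζ⟩` is the multiplication by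
the sum of the translates of `f` by the multiples of `ε`. -/
lemma sum_op_torusInner_smul (hε : eps θ p q ≠ 0) {f g : 𝓢(ℝ, ℂ)}
    (h0 : ∀ t, f t * star (g t) = f t)
    (hk : ∀ t (k : ℤ), k ≠ 0 → f t * star (g (t + k)) = 0) (ζ : Xi θ p W) (s : ℝ) (l : Fin q) :
    (∑ j, op (torusInner hε (tensorBasis θ p W g j) ζ) • tensorBasis θ p W f j : Xi θ p W) s l =
      (∑' n : ℤ, f (s - n * eps θ p q)) * ζ s l := by
  have hs : ∀ j, Summable fun x => innerCoeff (tensorBasis θ p W g j) ζ x •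
      weylShift θ p W x (tensorBasis θ p W f j) s := fun j =>
    summable (torusInner hε (tensorBasis θ p W g j) ζ) _ s
  have e1 : (∑ j, op (torusInner hε (tensorBasis θ p W g j) ζ) • tensorBasis θ p W f j :
      Xi θ p W) s = ∑' x : ℤ × ℤ, ∑ j, innerCoeff (tensorBasis θ p W g j) ζ x •
        weylShift θ p W x (tensorBasis θ p W f j) s := by
    rw [Summable.tsum_finsetSum fun j _ => hs j]
    exact sum_apply _ _ _
  have hs' := summable_sum fun j (_ : j ∈ Finset.univ) => hs j
  simp only [sum_innerCoeff_smul] at hs'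
  rw [e1]
  simp only [sum_innerCoeff_smul]
  rw [tsum_apply hs', (Pi.summable.mp hs' l).tsum_prod, ← tsum_mul_right]
  refine tsum_congr fun n => ?_
  dsimp only
  rw [tsum_mul_left, tsum_fourier_conjMulCoord, ← tsum_mul_left, tsum_eq_single 0]
  · rw [← mul_assoc, Int.cast_zero, add_zero, add_zero, h0]
  · intro k hk'
    rw [← mul_assoc, hk _ _ hk', zero_mul]

end Xi

end Reconstruction

/-! ### The frame of the Schwartz module -/

section ExistsFrame

/-- A smooth compactly supported real function as a complex valued Schwartz function. -/
def ofRealSchwartz (f : ℝ → ℝ) (hf : HasCompactSupport f) (hf' : ContDiff ℝ ∞ f) : 𝓢(ℝ, ℂ) :=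
  HasCompactSupport.toSchwartzMap (f := fun t => (f t : ℂ))
    (hf.comp_left (g := fun r : ℝ => (r : ℂ)) Complex.ofReal_zero)
    (Complex.ofRealCLM.contDiff.comp hf')

lemma ofRealSchwartz_apply (f : ℝ → ℝ) (hf : HasCompactSupport f) (hf' : ContDiff ℝ ∞ f)
    (t : ℝ) : ofRealSchwartz f hf hf' t = f t := rfl

/-- Finitely many functions `f i` whose translates by the multiples of `ε` form a partition of
unity, together with cutoffs `g i`, equal to `1` on the support of `f i`, whose translates by
nonzero integers vanish there. The sum of the integrals is forced, being the integral of `1` over a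
period. -/
lemma exists_schwartz_partition {ε : ℝ} (hε : ε ≠ 0) :
    ∃ (N : ℕ) (f g : Fin N → 𝓢(ℝ, ℂ)),
      (∀ i t, f i t * star (g i t) = f i t) ∧
      (∀ i t (k : ℤ), k ≠ 0 → f i t * star (g i (t + k)) = 0) ∧
      (∀ s, ∑ i, ∑' n : ℤ, f i (s - n * ε) = 1) ∧
      ∑ i, ∫ t, f i t = (|ε| : ℝ) := by
  -- the period is cut into steps `δ` of length at most `1 / 4`
  obtain ⟨M, hM⟩ := exists_nat_gt (4 * |ε|)
  have hM0 : (0 : ℝ) < M := lt_of_le_of_lt (by positivity) hM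
  have : NeZero M := ⟨by rintro rfl; simp at hM0⟩
  set δ := ε / M with hδ
  have hδ0 : δ ≠ 0 := div_ne_zero hε hM0.ne'
  have hδ1 : |δ| ≤ 1 / 4 := by
    rw [hδ, abs_div, Nat.abs_cast, div_le_iff₀ hM0]
    linarith
  have hδpos : 0 < |δ| := abs_pos.mpr hδ0
  let b : ContDiffBump (0 : ℝ) := ⟨1 / 4, 1 / 2, by norm_num, by norm_num⟩
  -- a point where the bump `unitBump (t / δ - i)` is nonzero is `|δ|`-close to `i δ`
  have hsupp : ∀ (i : ℕ) (t : ℝ), |δ| ≤ |t - i * δ| → unitBump (t / δ - i) = 0 := fun i t h => by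
    refine unitBump_of_one_le_abs ?_
    have e : t / δ - i = (t - i * δ) / δ := by field_simp
    rwa [e, abs_div, le_div_iff₀ hδpos, one_mul]
  have hf : ∀ i : Fin M, HasCompactSupport fun t : ℝ => unitBump (t / δ - (i : ℕ)) := fun i =>
    HasCompactSupport.intro (isCompact_closedBall ((i : ℕ) * δ) |δ|) fun t ht => by
      refine hsupp i t (le_of_not_ge fun h => ht ?_)
      rwa [Metric.mem_closedBall, Real.dist_eq]
  have hf' : ∀ i : Fin M, ContDiff ℝ ∞ fun t : ℝ => unitBump (t / δ - (i : ℕ)) := fun i =>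
    contDiff_unitBump.comp ((contDiff_id.div_const δ).sub contDiff_const)
  have hg : ∀ i : Fin M, HasCompactSupport fun t : ℝ => b (t - (i : ℕ) * δ) := fun i =>
    HasCompactSupport.intro (isCompact_closedBall ((i : ℕ) * δ) (1 / 2)) fun t ht => by
      refine b.zero_of_le_dist (le_of_not_ge fun h => ht ?_)
      rw [Metric.mem_closedBall, Real.dist_eq]
      rwa [dist_zero_right, Real.norm_eq_abs] at h
  have hg' : ∀ i : Fin M, ContDiff ℝ ∞ fun t : ℝ => b (t - (i : ℕ) * δ) := fun i =>
    b.contDiff.comp (contDiff_id.sub contDiff_const)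
  refine ⟨M, fun i => ofRealSchwartz _ (hf i) (hf' i), fun i => ofRealSchwartz _ (hg i) (hg' i),
    ?_, ?_, ?_, ?_⟩
  · intro i t
    simp only [ofRealSchwartz_apply, Complex.star_def, Complex.conj_ofReal]
    by_cases h : |δ| ≤ |t - (i : ℕ) * δ|
    · rw [hsupp i t h, Complex.ofReal_zero, zero_mul]
    · rw [b.one_of_mem_closedBall, Complex.ofReal_one, mul_one]
      rw [mem_closedBall_zero_iff, Real.norm_eq_abs]
      exact (le_of_not_ge h).trans hδ1
  · intro i t k hk
    simp only [ofRealSchwartz_apply, Complex.star_def, Complex.conj_ofReal]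
    by_cases h : |δ| ≤ |t - (i : ℕ) * δ|
    · rw [hsupp i t h, Complex.ofReal_zero, zero_mul]
    · rw [b.zero_of_le_dist, Complex.ofReal_zero, mul_zero]
      rw [dist_zero_right, Real.norm_eq_abs]
      have hk1 : (1 : ℝ) ≤ |(k : ℝ)| := by exact_mod_cast Int.one_le_abs hk
      have h1 := abs_sub_abs_le_abs_add (k : ℝ) (t - (i : ℕ) * δ)
      have e : t + k - (i : ℕ) * δ = k + (t - (i : ℕ) * δ) := by ring
      rw [e]
      change (1 / 2 : ℝ) ≤ _
      linarith
  · intro s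
    simp only [ofRealSchwartz_apply]
    have h := hasSum_unitBump_step (N := M) hε s
    have hi : ∀ i : Fin M, Summable fun n : ℤ => unitBump ((s - n * ε) / δ - (i : ℕ)) := fun i =>
      h.summable.comp_injective (i := fun n : ℤ => (n, i)) fun m n hmn => congrArg Prod.fst hmn
    simp only [← Complex.ofReal_tsum]
    rw [← Complex.ofReal_sum, ← Summable.tsum_finsetSum fun i _ => hi i]
    have h2 := h.prod_fiberwise fun n => hasSum_fintype _
    rw [h2.tsum_eq, Complex.ofReal_one]
  · simp only [ofRealSchwartz_apply, integral_complex_ofReal]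
    have h : ∀ i : Fin M, ∫ t : ℝ, unitBump (t / δ - (i : ℕ)) = |δ| := fun i => by
      rw [MeasureTheory.Measure.integral_comp_div (fun t => unitBump (t - (i : ℕ))) δ,
        MeasureTheory.integral_sub_right_eq_self (fun t => unitBump t), integral_unitBump,
        smul_eq_mul, mul_one]
    simp only [h]
    rw [← Complex.ofReal_sum, Finset.sum_const, Finset.card_univ, Fintype.card_fin, nsmul_eq_mul,
      hδ, abs_div, Nat.abs_cast, mul_div_cancel₀ _ hM0.ne']

namespace Xi

open MulOpposite (op)

variable {θ : ℝ} {p : ℤ} {q : ℕ} {W : WeylPair q}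

lemma l2Inner_tensorBasis {f g : 𝓢(ℝ, ℂ)} (h : ∀ t, f t * star (g t) = f t) (j : Fin q) :
    l2Inner (tensorBasis θ p W g j) (tensorBasis θ p W f j) = ∫ t, f t := by
  unfold l2Inner
  congr 1
  funext t
  rw [tensorBasis_apply, tensorBasis_apply, star_smul, smul_dotProduct, dotProduct_smul,
    ← Pi.single_star, star_one, single_dotProduct, Pi.single_eq_same, smul_eq_mul, smul_eq_mul,
    mul_one, mul_one, mul_comm, h]

/-- The Schwartz module has a finite frame whose projection has trace `q |ε| = |p - q θ|`. -/
lemma exists_frame [NeZero q] (hε : eps θ p q ≠ 0) :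
    ∃ (n : ℕ) (F : Frame θ (Xi θ p W) n), matrixTrace F.projection = (|p - q * θ| : ℝ) := by
  obtain ⟨N, f, g, h0, hk, hsum, hint⟩ := exists_schwartz_partition hε
  have key : ∀ ξ : Xi θ p W, ∑ x : Fin N × Fin q,
      op (torusInner hε (tensorBasis θ p W (g x.1) x.2) ξ) • tensorBasis θ p W (f x.1) x.2 = ξ := by
    intro ξ
    rw [Fintype.sum_prod_type]
    apply DFunLike.ext
    intro s
    funext l
    have e : (∑ i, ∑ j, op (torusInner hε (tensorBasis θ p W (g i) j) ξ) •
        tensorBasis θ p W (f i) j : Xi θ p W) s = ∑ i, (∑ j, op (torusInner hε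
          (tensorBasis θ p W (g i) j) ξ) • tensorBasis θ p W (f i) j : Xi θ p W) s :=
      sum_apply _ _ _
    rw [e, Finset.sum_apply]
    simp only [sum_op_torusInner_smul hε (h0 _) (hk _)]
    rw [← Finset.sum_mul, hsum, one_mul]
  refine ⟨_, Frame.ofFintype _ _ key, ?_⟩
  rw [Frame.matrixTrace_projection_ofFintype, Fintype.sum_prod_type]
  simp only [trace_torusInner, l2Inner_tensorBasis (h0 _)]
  simp only [Finset.sum_const, Finset.card_univ, Fintype.card_fin, nsmul_eq_mul]
  rw [← Finset.mul_sum, hint]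
  have hq : (q : ℝ) ≠ 0 := Nat.cast_ne_zero.mpr (NeZero.ne q)
  have e : (p - q * θ : ℝ) = q * eps θ p q := by
    unfold eps
    field_simp
  rw [e, abs_mul, Nat.abs_cast]
  push_cast
  rfl

end Xi

end ExistsFrame

end NCTorus

end

theorem theorem6 (θ : ℝ) (hθ : Irrational θ) (p : ℤ) (q : ℕ) [NeZero q] (W : WeylPair q) :
    -- the right module structure on the Schwartz space
    (∀ (ξ : Xi θ p W) (s : ℝ), (MulOpposite.op (SmoothTorus.U₁ : SmoothTorus θ) • ξ) s =
      (W.W₁ : Matrix (Fin q) (Fin q) ℂ).mulVec (ξ (s - eps θ p q))) ∧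
    (∀ (ξ : Xi θ p W) (s : ℝ), (MulOpposite.op (SmoothTorus.U₂ : SmoothTorus θ) • ξ) s =
      Complex.exp (2 * Real.pi * Complex.I * s) •
        ((W.W₂ ^ p : Matrix.unitaryGroup (Fin q) ℂ) : Matrix (Fin q) (Fin q) ℂ).mulVec (ξ s)) ∧
    -- it is projective of finite type, of dimension `|p - q θ|`
    Module.Finite (SmoothTorus θ)ᵐᵒᵖ (Xi θ p W) ∧
    Module.Projective (SmoothTorus θ)ᵐᵒᵖ (Xi θ p W) ∧
    HasDimension θ (Xi θ p W) |p - q * θ| ∧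
    -- the two operators define a connection, of constant curvature
    ∃ D : Connection θ (Xi θ p W),
      (∀ (ξ : Xi θ p W) (s : ℝ), D.toLinearMap ![1, 0] ξ s =
        (2 * Real.pi * Complex.I * s / eps θ p q) • ξ s) ∧
      (∀ (ξ : Xi θ p W) (s : ℝ), D.toLinearMap ![0, 1] ξ s = deriv ξ s) ∧
      (∀ ξ : Xi θ p W, D.curvature ![1, 0] ![0, 1] ξ =
        (2 * Real.pi * Complex.I * (1 / (θ - p / q)) : ℂ) • ξ) ∧
      -- the total curvature is `± q`
      D.HasTotalCurvature (|p - q * θ| / (θ - p / q)) ∧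
      (|p - q * θ| / (θ - p / q) = q ∨ |p - q * θ| / (θ - p / q) = -q) := by
  have hq : (q : ℝ) ≠ 0 := Nat.cast_ne_zero.mpr (NeZero.ne q)
  have hε : eps θ p q ≠ 0 := sub_ne_zero.mpr fun h => hθ ⟨(p / q : ℚ), by push_cast; exact h⟩
  have hε' : θ - p / q ≠ 0 := fun h => hε (by unfold eps; linarith)
  obtain ⟨n, F, hF⟩ := Xi.exists_frame (W := W) hε
  refine ⟨Xi.op_smul_U₁, Xi.op_smul_U₂, F.module_finite, F.module_projective, F.hasDimension hF,
    Xi.connection hε W, fun ξ s => ?_, fun ξ s => ?_, Xi.connection_curvature hε W, ?_, ?_⟩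
  · rw [Xi.connection_fst, Xi.nabla₁_apply]
  · rw [Xi.connection_snd, Xi.nabla₂_apply]
  · have h := F.hasEndTrace (Xi.connection_curvature hε W)
    rw [hF] at h
    unfold Connection.HasTotalCurvature
    convert h using 1
    push_cast
    ring
  · have e : (p - q * θ : ℝ) = -(q * (θ - p / q)) := by
      field_simp
      ring
    rw [e, abs_neg, abs_mul, Nat.abs_cast]
    rcases abs_choice (θ - p / q) with h | h
    · left
      rw [h, mul_div_assoc, div_self hε', mul_one]
    · right
      rw [h, mul_div_assoc, neg_div, div_self hε', mul_neg_one]
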